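/- **Lemma 3.5 (off-shell relation in the diagonal case).** Let $q\in\mathbb{C}^*$ not be a root of unity, let $s\in\frac12\mathbb{Z}_{\ge 0}$, and let $\mu,\mu',\nu,\nu',v\in\mathbb{C}$ with $v\neq0$ (non-integer powers of $q$ are taken with a fixed branch of $\log q$). Put $b(x)=x-x^{-1}$, $[X,Y]_q=qXY-q^{-1}YX$, $p=q^{(\nu+\nu')/2}$, $\chi=-\frac12q^{\nu}(q^2-q^{-2})$, and $$b=\tfrac12 p\,e^{-\mu}q^{-2s},\quad c=\tfrac12 p\,e^{\mu}q^{2s},\quad b^*=\tfrac12 p\,e^{\mu'}q^{-2s},\quad c^*=\tfrac12 p\,e^{-\mu'}q^{2s},$$ $$\theta_M=bq^{2M}+cq^{-2M},\qquad \theta^*_M=b^*q^{2M}+c^*q^{-2M},$$ $$\rho=-\tfrac14p^2(q^2-q^{-2})^2,\qquad \omega=\tfrac14p^2(q-q^{-1})^2\big((v^2+v^{-2})(q^{2s+1}+q^{-2s-1})-4\cosh\mu\cosh\mu'\big),$$ $$\eta=-\tfrac14p^3\tfrac{(q^2-q^{-2})^2}{q+q^{-1}}\big(\cosh\mu\,(v^2+v^{-2})-\cosh\mu'\,(q^{2s+1}+q^{-2s-1})\big),$$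 $$\eta^*=-\tfrac14p^3\tfrac{(q^2-q^{-2})^2}{q+q^{-1}}\big(\cosh\mu'\,(v^2+v^{-2})-\cosh\mu\,(q^{2s+1}+q^{-2s-1})\big).$$ The Askey–Wilson algebra is generated by $\mathsf A,\mathsf A^*$ subject to $$[\mathsf A,[\mathsf A,\mathsf A^*]_q]_{q^{-1}}=\rho\mathsf A^*+\omega\mathsf A+\eta,\qquad [\mathsf A^*,[\mathsf A^*,\mathsf A]_q]_{q^{-1}}=\rho\mathsf A+\omega\mathsf A^*+\eta^*.$$ Let $(\bar\pi,\bar{\mathcal V})$ be an irreducible complex representation of dimension $2s+1$ on which $\mathsf A$ and $\mathsf A^*$ are diagonalizable with multiplicity-free spectra $\theta_0,\dots,\theta_{2s}$ and $\theta^*_0,\dots,\theta^*_{2s}$ and eigenvectors $|\theta_M\rangle$, $|\theta^*_M\rangle$ respectively. Let $K(u)$ be the $2\times2$ matrix with entries $$K_{11}(u)=b(u^2)(qu\mathsf A-q^{-1}u^{-1}\mathsf A^*)-(q+q^{-1})\rho^{-1}(\eta u+\eta^*u^{-1}),$$ $$K_{22}(u)=b(u^2)(qu\mathsf A^*-q^{-1}u^{-1}\mathsf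 A)-(q+q^{-1})\rho^{-1}(\eta^*u+\eta u^{-1}),$$ $$K_{12}(u)=\chi\, b(u^2)\Big(\rho^{-1}\big([\mathsf A^*,\mathsf A]_q+\tfrac{\omega}{q-q^{-1}}\big)+\tfrac{qu^2+q^{-1}u^{-2}}{q^2-q^{-2}}\Big),$$ $$K_{21}(u)=\rho\chi^{-1} b(u^2)\Big(\rho^{-1}\big([\mathsf A,\mathsf A^*]_q+\tfrac{\omega}{q-q^{-1}}\big)+\tfrac{qu^2+q^{-1}u^{-2}}{q^2-q^{-2}}\Big).$$ For $\epsilon=\pm1$, gauge parameters $\alpha,\beta\in\mathbb{C}$ and $m\in\mathbb{Z}$ let $$\gamma^\epsilon(u,m)=\alpha^{\frac{1-\epsilon}2}\beta^{\frac{1+\epsilon}2}q^{-m}u-\alpha^{\frac{1+\epsilon}2}\beta^{\frac{1-\epsilon}2}q^{m}u^{-1},$$ $$|Y^\epsilon(u,m)\rangle=\begin{pmatrix}\beta q^{-\epsilon m}u^\epsilon\\1\end{pmatrix},\qquad \langle\tilde Y^\epsilon(u,m)|=-\epsilon\frac{q^{-\epsilon}u^{-\epsilon}}{\gamma^\epsilon(1,m+1)}\begin{pmatrix}1&-\beta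 q^{-\epsilon m}u^\epsilon\end{pmatrix},$$ $$\mathscr B^\epsilon(u,m)=\langle\tilde Y^\epsilon(u,m)|K(u)|Y^\epsilon(u^{-1},m)\rangle .$$ Let $m_0\in\mathbb{Z}$ and $\epsilon\in\{1,-1\}$. Take $\beta=0$, and let $\alpha$ be fixed by $(q^2-q^{-2})\chi^{-1}\alpha c^*q^{m_0}=1$ if $\epsilon=1$, and by $(q^2-q^{-2})\chi^{-1}\alpha b\,q^{-m_0}=-1$ if $\epsilon=-1$. Put $|\Omega^+\rangle=|\theta_0^*\rangle$, $|\Omega^-\rangle=|\theta_0\rangle$ and, for $\bar u=(u_1,\dots,u_{2s})$, $$|\Psi(\bar u)\rangle=\bar\pi\big(\mathscr B^\epsilon(u_1,m_0+2(2s-1))\cdots\mathscr B^\epsilon(u_{2s-1},m_0+2)\,\mathscr B^\epsilon(u_{2s},m_0)\big)|\Omega^\epsilon\rangle ,$$ and let $|\Psi(\{u,\bar u_i\})\rangle$ be the same vector with $u_i$ replaced by $u$. Then, for all $u,u_1,\dots,u_{2s}\in\mathbb{C}^*$ such that none of the denominators below vanishes, that is $b(uu_i^{-1})\,b(q^{-1}u^{-1}u_i^{-1})\ne0$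 for all $i$ and $b(u_iu_j^{-1})\,b(q^{-1}u_i^{-1}u_j^{-1})\neq0$ for all $i\ne j$, one has $$\bar\pi(\mathscr B^\epsilon(u,m_0+4s))|\Psi(\bar u)\rangle=\delta_d\,\frac{u^{-\epsilon}b(u^2)\prod_{k=0}^{2s}b(q^{1/2+k-s}vu)\,b(q^{1/2+k-s}v^{-1}u)}{\prod_{i=1}^{2s}b(uu_i^{-1})\,b(q^{-1}u^{-1}u_i^{-1})}\,|\Psi(\bar u)\rangle$$ $$\qquad-\delta_d\sum_{i=1}^{2s}\frac{u_i^{-\epsilon}b(u_i^2)\prod_{k=0}^{2s}b(q^{1/2+k-s}vu_i)\,b(q^{1/2+k-s}v^{-1}u_i)}{b(uu_i^{-1})\,b(q^{-1}u^{-1}u_i^{-1})\prod_{j\ne i}b(u_iu_j^{-1})\,b(q^{-1}u_i^{-1}u_j^{-1})}\,|\Psi(\{u,\bar u_i\})\rangle,$$ where $$\delta_d=-\frac{\epsilon(-1)^{2s+1}}2\,e^{-\mu(1-\epsilon)/2-\mu'(1+\epsilon)/2}\,q^{(\nu+\nu')/2-\epsilon(2s+2)}.$$ -/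

import Mathlib

namespace AskeyWilson

noncomputable section

/-- The scalar parameters: `q` is nonzero and not a root of unity, `N = 2s` is a natural number
(so `s` is an integer or a half-integer), `μ, μ', ν, ν', v` are complex with `v ≠ 0`.
Powers of `q` with non-integer exponents are complex powers. -/
structure Params where
  q : ℂ
  N : ℕ
  μ : ℂ
  μ' : ℂ
  ν : ℂ
  ν' : ℂ
  v : ℂ
  q_ne_zero : q ≠ 0
  q_not_root : ∀ n : ℕ, 0 < n → q ^ n ≠ 1
  v_ne_zero : v ≠ 0

/-- The function `b(x) = x - x⁻¹`. -/
def bfun (x : ℂ) : ℂ := x - x⁻¹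

namespace Params

variable (P : Params)

/-- The spin `s`, with `2s = N`. -/
def s : ℂ := (P.N : ℂ) / 2

/-- The scalar `b`. -/
def b : ℂ := 1 / 2 * P.q ^ ((P.ν + P.ν') / 2) * Complex.exp (-P.μ) * P.q ^ (-(P.N : ℤ))

/-- The scalar `c`. -/
def c : ℂ := 1 / 2 * P.q ^ ((P.ν + P.ν') / 2) * Complex.exp P.μ * P.q ^ (P.N : ℤ)

/-- The scalar `b*`. -/
def bStar : ℂ := 1 / 2 * P.q ^ ((P.ν + P.ν') / 2) * Complex.exp P.μ' * P.q ^ (-(P.N : ℤ))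

/-- The scalar `c*`. -/
def cStar : ℂ := 1 / 2 * P.q ^ ((P.ν + P.ν') / 2) * Complex.exp (-P.μ') * P.q ^ (P.N : ℤ)

/-- The eigenvalue `θ_M = b q^{2M} + c q^{-2M}`. -/
def θ (M : ℤ) : ℂ := P.b * P.q ^ (2 * M) + P.c * P.q ^ (-(2 * M))

/-- The eigenvalue `θ*_M = b* q^{2M} + c* q^{-2M}`. -/
def θStar (M : ℤ) : ℂ := P.bStar * P.q ^ (2 * M) + P.cStar * P.q ^ (-(2 * M))

/-- The scalar `χ`. -/
def χ : ℂ := -(1 / 2) * P.q ^ P.ν * (P.q ^ 2 - (P.q ^ 2)⁻¹)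

/-- The structure constant `ρ`. -/
def ρ : ℂ := -(1 / 4) * P.q ^ (P.ν + P.ν') * (P.q ^ 2 - (P.q ^ 2)⁻¹) ^ 2

/-- The structure constant `ω`. -/
def ω : ℂ :=
  1 / 4 * P.q ^ (P.ν + P.ν') * (P.q - P.q⁻¹) ^ 2 *
    ((P.v ^ 2 + (P.v ^ 2)⁻¹) * (P.q ^ (P.N + 1) + (P.q ^ (P.N + 1))⁻¹)
      - 4 * Complex.cosh P.μ * Complex.cosh P.μ')

/-- The structure constant `η`. -/
def η : ℂ :=
  -(1 / 4) * P.q ^ (3 / 2 * (P.ν + P.ν')) *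
    ((P.q ^ 2 - (P.q ^ 2)⁻¹) ^ 2 / (P.q + P.q⁻¹)) *
    (Complex.cosh P.μ * (P.v ^ 2 + (P.v ^ 2)⁻¹)
      - Complex.cosh P.μ' * (P.q ^ (P.N + 1) + (P.q ^ (P.N + 1))⁻¹))

/-- The structure constant `η*`. -/
def ηStar : ℂ :=
  -(1 / 4) * P.q ^ (3 / 2 * (P.ν + P.ν')) *
    ((P.q ^ 2 - (P.q ^ 2)⁻¹) ^ 2 / (P.q + P.q⁻¹)) *
    (Complex.cosh P.μ' * (P.v ^ 2 + (P.v ^ 2)⁻¹)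
      - Complex.cosh P.μ * (P.q ^ (P.N + 1) + (P.q ^ (P.N + 1))⁻¹))

end Params

/-- The `q`-commutator `[X, Y]_q = q X Y - q⁻¹ Y X`. -/
def qComm {R : Type*} [Ring R] [Algebra ℂ R] (q : ℂ) (X Y : R) : R :=
  q • (X * Y) - q⁻¹ • (Y * X)

/-- Names of the two generators. -/
inductive Gen
  | A
  | AStar

/-- The Askey-Wilson relations on the free algebra on two generators. -/
inductive Rel (P : Params) : FreeAlgebra ℂ Gen → FreeAlgebra ℂ Gen → Prop
  | aw1 : Rel P
      (qComm P.q⁻¹ (FreeAlgebra.ι ℂ Gen.A)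
        (qComm P.q (FreeAlgebra.ι ℂ Gen.A) (FreeAlgebra.ι ℂ Gen.AStar)))
      (P.ρ • FreeAlgebra.ι ℂ Gen.AStar + P.ω • FreeAlgebra.ι ℂ Gen.A + P.η • 1)
  | aw2 : Rel P
      (qComm P.q⁻¹ (FreeAlgebra.ι ℂ Gen.AStar)
        (qComm P.q (FreeAlgebra.ι ℂ Gen.AStar) (FreeAlgebra.ι ℂ Gen.A)))
      (P.ρ • FreeAlgebra.ι ℂ Gen.A + P.ω • FreeAlgebra.ι ℂ Gen.AStar + P.ηStar • 1)

/-- The Askey-Wilson algebra. -/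
abbrev Alg (P : Params) : Type := RingQuot (Rel P)

/-- The generator `A`. -/
def genA (P : Params) : Alg P := RingQuot.mkAlgHom ℂ (Rel P) (FreeAlgebra.ι ℂ Gen.A)

/-- The generator `A*`. -/
def genAStar (P : Params) : Alg P := RingQuot.mkAlgHom ℂ (Rel P) (FreeAlgebra.ι ℂ Gen.AStar)

/-- An irreducible representation of dimension `2s + 1` of the Askey-Wilson algebra on which `A`
and `A*` are diagonalizable with multiplicity-free spectra `θ_0, …, θ_{2s}` and
`θ*_0, …, θ*_{2s}`, together with eigenbases. -/
structure Rep (P : Params) (V : Type*) [AddCommGroup V] [Module ℂ V] where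
  π : Alg P →ₐ[ℂ] Module.End ℂ V
  irreducible : ∀ W : Submodule ℂ V, (∀ x : Alg P, ∀ w ∈ W, π x w ∈ W) → W = ⊥ ∨ W = ⊤
  ket : Module.Basis (Fin (P.N + 1)) ℂ V
  ketStar : Module.Basis (Fin (P.N + 1)) ℂ V
  A_ket : ∀ M : Fin (P.N + 1), π (genA P) (ket M) = P.θ (M : ℕ) • ket M
  AStar_ketStar : ∀ M : Fin (P.N + 1), π (genAStar P) (ketStar M) = P.θStar (M : ℕ) • ketStar M
  θ_injective : Function.Injective fun M : Fin (P.N + 1) => P.θ (M : ℕ)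
  θStar_injective : Function.Injective fun M : Fin (P.N + 1) => P.θStar (M : ℕ)

/-- The `K`-matrix, a `2 × 2` matrix over the Askey-Wilson algebra solving the reflection
equation. -/
def K (P : Params) (u : ℂ) : Matrix (Fin 2) (Fin 2) (Alg P) :=
  !![(u ^ 2 - (u ^ 2)⁻¹) • ((P.q * u) • genA P - (P.q⁻¹ * u⁻¹) • genAStar P)
        - ((P.q + P.q⁻¹) * P.ρ⁻¹ * (P.η * u + P.ηStar * u⁻¹)) • (1 : Alg P),
      (P.χ * (u ^ 2 - (u ^ 2)⁻¹)) •
        (P.ρ⁻¹ • (qComm P.q (genAStar P) (genA P) + (P.ω / (P.q - P.q⁻¹)) • (1 : Alg P))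
          + ((P.q * u ^ 2 + P.q⁻¹ * (u ^ 2)⁻¹) / (P.q ^ 2 - (P.q ^ 2)⁻¹)) • (1 : Alg P));
      (P.ρ * P.χ⁻¹ * (u ^ 2 - (u ^ 2)⁻¹)) •
        (P.ρ⁻¹ • (qComm P.q (genA P) (genAStar P) + (P.ω / (P.q - P.q⁻¹)) • (1 : Alg P))
          + ((P.q * u ^ 2 + P.q⁻¹ * (u ^ 2)⁻¹) / (P.q ^ 2 - (P.q ^ 2)⁻¹)) • (1 : Alg P)),
      (u ^ 2 - (u ^ 2)⁻¹) • ((P.q * u) • genAStar P - (P.q⁻¹ * u⁻¹) • genA P)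
        - ((P.q + P.q⁻¹) * P.ρ⁻¹ * (P.ηStar * u + P.η * u⁻¹)) • (1 : Alg P)]

/-- The function `γ^ε(u, m)`; the sign `ε` is a unit of `ℤ`, and the exponents `(1 ± ε) / 2` are
the integers `0` and `1`. -/
def γ (P : Params) (α β : ℂ) (ε : ℤˣ) (u : ℂ) (m : ℤ) : ℂ :=
  α ^ ((1 - (ε : ℤ)) / 2) * β ^ (((ε : ℤ) + 1) / 2) * P.q ^ (-m) * u
    - α ^ (((ε : ℤ) + 1) / 2) * β ^ ((1 - (ε : ℤ)) / 2) * P.q ^ m * u⁻¹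

/-- The covariant vector `|Y^ε(u, m)⟩`. -/
def covY (P : Params) (β : ℂ) (ε : ℤˣ) (u : ℂ) (m : ℤ) : Fin 2 → ℂ :=
  ![β * P.q ^ (-((ε : ℤ) * m)) * u ^ (ε : ℤ), 1]

/-- The contravariant vector `⟨Ỹ^ε(u, m)|`. -/
def contraY (P : Params) (α β : ℂ) (ε : ℤˣ) (u : ℂ) (m : ℤ) : Fin 2 → ℂ :=
  (-((ε : ℤ) : ℂ) * (P.q ^ (-(ε : ℤ)) * u ^ (-(ε : ℤ)) / γ P α β ε 1 (m + 1))) •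
    ![1, -(β * P.q ^ (-((ε : ℤ) * m)) * u ^ (ε : ℤ))]

/-- The dynamical operator `ℬ^ε(u, m) = ⟨Ỹ^ε(u, m)| K(u) |Y^ε(u⁻¹, m)⟩` in the gauge `(α, β)`. -/
def dynB (P : Params) (α β : ℂ) (ε : ℤˣ) (u : ℂ) (m : ℤ) : Alg P :=
  ∑ i, ∑ j, (contraY P α β ε u m i * covY P β ε u⁻¹ m j) • K P u i j

/-- The string `B^ε(ū, m, M) = ℬ^ε(u_1, m + 2(M-1)) ⋯ ℬ^ε(u_M, m)` (here `u_1, …, u_M` are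
`ū 0, …, ū (M-1)`). -/
def stringB (P : Params) (α β : ℂ) (ε : ℤˣ) {M : ℕ} (ubar : Fin M → ℂ) (m : ℤ) : Alg P :=
  (List.ofFn fun i : Fin M => dynB P α β ε (ubar i) (m + 2 * ((M : ℤ) - 1 - ((i : ℕ) : ℤ)))).prod

/-- The reference state: `|Ω⁺⟩ = |θ*_0⟩` and `|Ω⁻⟩ = |θ_0⟩`. -/
def refState {P : Params} {V : Type*} [AddCommGroup V] [Module ℂ V] (R : Rep P V) (ε : ℤˣ) : V :=
  if ε = 1 then R.ketStar 0 else R.ket 0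

/-- The condition that fixes the gauge parameter `α` for the reference state `|Ω^ε⟩`. -/
def RefGauge (P : Params) (α : ℂ) (ε : ℤˣ) (m₀ : ℤ) : Prop :=
  if ε = 1 then (P.q ^ 2 - (P.q ^ 2)⁻¹) * P.χ⁻¹ * α * P.cStar * P.q ^ m₀ = 1
  else (P.q ^ 2 - (P.q ^ 2)⁻¹) * P.χ⁻¹ * α * P.b * P.q ^ (-m₀) = -1

/-- The Bethe vector `|Ψ^{2s}_{d,ε}(ū, m₀)⟩`, in the gauge `β = 0`. -/
def betheVec {P : Params} {V : Type*} [AddCommGroup V] [Module ℂ V] (R : Rep P V)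
    (α : ℂ) (ε : ℤˣ) (ubar : Fin P.N → ℂ) (m₀ : ℤ) : V :=
  R.π (stringB P α 0 ε ubar m₀) (refState R ε)

/-- The coefficient `δ_d`. -/
def δd (P : Params) (ε : ℤˣ) : ℂ :=
  -(((ε : ℤ) : ℂ) * (-1) ^ (P.N + 1) / 2) *
    Complex.exp (-P.μ * (1 - ((ε : ℤ) : ℂ)) / 2 - P.μ' * (1 + ((ε : ℤ) : ℂ)) / 2) *
    P.q ^ ((P.ν + P.ν') / 2 - ((ε : ℤ) : ℂ) * (2 * P.s + 2))

end

end AskeyWilson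

namespace AskeyWilson

noncomputable section

/-! In the gauge `β = 0` only the entry `K₁₂` survives, and it is affine in one operator `C`
(`Rep.third`). Each `ℬ^ε(u, m)` acts as a scalar times `ξ(u) - C`, where `ξ(u) = q u² + q⁻¹ u⁻²`
(`Rep.map_dynB`). All these operators commute, and the Bethe vector is a polynomial of degree `N` in
`C` applied to the reference state. The off-shell relation is Lagrange interpolation of `(ξ(u) - X)
∏ (ξ(u_i) - X)` at the nodes `ξ(u), ξ(u_i)`, modulo a monic polynomial of degree `N + 1` that
annihilates `C` (`prod_sub_X_eq_interpolation`). The denominators are differences of nodes, and the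
products over `k` are values of the annihilating polynomial.

The real content is that `∏ (C - z_k) = 0` with `z_k = v² q^{2k-N} + v⁻² q^{N-2k}`
(`Rep.aeval_third_eq_zero`). After rescaling, `A`, `B = A*` and `C` satisfy three cyclic
`q`-commutation relations. Let `f₀` be the first vector of an eigenbasis of `B`, with eigenvalues
`y_k`, and let `W_k = ∏_{i<k} (C - z_i) f₀`. The relations give `B W_k = y_k W_k + φ_k W_{k-1}` with
explicit `φ_k` (`CyclicRelations.split_form`). Since `φ_{N+1} = 0` while `y_{N+1}` is not an
eigenvalue of `B`, `W_{N+1} = 0`. The span of the `W_k` is invariant, so by irreducibility it is all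
of `V`, and the product kills `V`. The `z_k` may coincide; diagonalizability of `C` is never used.

The induction starts from the diagonal entry of `A` at `f₀`, obtained from the trace of `A`
(`CyclicRelations.first_diag_entry`). -/

/-- The value `x r² + (x r²)⁻¹`; at `r = q ^ k` this is the `k`-th term of a `q`-quadratic
eigenvalue sequence. -/
def ladder (x r : ℂ) : ℂ := x * r ^ 2 + (x * r ^ 2)⁻¹

/-- The superdiagonal entries of the split form of a pair with eigenvalue sequences
`ladder x (q ^ k)` and `ladder y (q ^ k)`; here `r = q ^ k` and `T = q ^ N`. -/
def splitCoeff (q T x y c r : ℂ) : ℂ :=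
  (x * y * T)⁻¹ * q * (r - r⁻¹) * (r / (q * T) - q * T / r) *
    (r⁻¹ + x * y * T * c * r / q) * (r⁻¹ + x * y * T * r / (q * c))

/-! ### Rational identities for eigenvalue sequences and split coefficients -/

section Scalars

variable {q T x y z r : ℂ}

theorem splitCoeff_one (x y c : ℂ) : splitCoeff q T x y c 1 = 0 := by
  simp [splitCoeff]

theorem splitCoeff_last (x y c : ℂ) : splitCoeff q T x y c (q * T) = 0 := by
  simp [splitCoeff]

theorem ladder_sub (hx : x ≠ 0) {r₁ r₂ : ℂ} (h₁ : r₁ ≠ 0) (h₂ : r₂ ≠ 0) :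
    ladder x r₁ - ladder x r₂ = (r₁ ^ 2 - r₂ ^ 2) * (x ^ 2 * r₁ ^ 2 * r₂ ^ 2 - 1) /
      (x * r₁ ^ 2 * r₂ ^ 2) := by
  unfold ladder; field_simp; ring

/-- Source of tridiagonality: the quadratic form attached to the cubic relation vanishes exactly at
the two neighbouring eigenvalues. -/
theorem ladder_quadratic (hq : q ≠ 0) (hx : x ≠ 0) (hr : r ≠ 0) (t : ℂ) :
    t ^ 2 - (q ^ 2 + (q ^ 2)⁻¹) * ladder x r * t + ladder x r ^ 2 + (q ^ 2 - (q ^ 2)⁻¹) ^ 2 =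
      (t - ladder x (r * q)) * (t - ladder x (r / q)) := by
  unfold ladder; field_simp; ring

theorem ladder_recurrence (hq : q ≠ 0) (hx : x ≠ 0) (hr : r ≠ 0) :
    ladder x r - (q ^ 2 + (q ^ 2)⁻¹) * ladder x (r * q) + ladder x (r * q ^ 2) = 0 := by
  unfold ladder; field_simp; ring

theorem ladder_consecutive (hq : q ≠ 0) (hx : x ≠ 0) (hr : r ≠ 0) :
    ladder x (r / q) ^ 2 - (q ^ 2 + (q ^ 2)⁻¹) * ladder x r * ladder x (r / q) + ladder x r ^ 2
      + (q ^ 2 - (q ^ 2)⁻¹) ^ 2 = 0 := by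
  linear_combination ladder_quadratic hq hx hr (ladder x (r / q))

/-- The value of `a` is written so that its corrections to `ladder x r` telescope when summed over
`r = q ^ k`. -/
theorem diag_entry_eq (hq : q ≠ 0) (hT : T ≠ 0) (hx : x ≠ 0) (hy : y ≠ 0) (hz : z ≠ 0)
    (hr : r ≠ 0) (h₁ : ladder y r - ladder y (r * q) ≠ 0) (h₂ : ladder y r - ladder y (r / q) ≠ 0)
    {a : ℂ}
    (h : (ladder y r - ladder y (r * q)) * (ladder y r - ladder y (r / q)) * a =
      (q - q⁻¹) ^ 2 * ((z * T + (z * T)⁻¹) * (q * T + (q * T)⁻¹)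
        - (x * T + (x * T)⁻¹) * (y * T + (y * T)⁻¹)) * ladder y r
      - (q ^ 2 - (q ^ 2)⁻¹) * (q - q⁻¹) * ((y * T + (y * T)⁻¹) * (z * T + (z * T)⁻¹)
        - (x * T + (x * T)⁻¹) * (q * T + (q * T)⁻¹))) :
    a = ladder x r + splitCoeff q T x y (z * T) r / (ladder y r - ladder y (r / q))
      - splitCoeff q T x y (z * T) (r * q) / (ladder y (r * q) - ladder y r) := by
  have h₁' : ladder y (r * q) - ladder y r ≠ 0 := by
    rw [← neg_sub]; exact neg_ne_zero.mpr h₁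
  apply mul_left_cancel₀ (mul_ne_zero h₁ h₂)
  rw [h]
  have e : (ladder y r - ladder y (r * q)) * (ladder y r - ladder y (r / q)) *
      (ladder x r + splitCoeff q T x y (z * T) r / (ladder y r - ladder y (r / q))
      - splitCoeff q T x y (z * T) (r * q) / (ladder y (r * q) - ladder y r)) =
      (ladder y r - ladder y (r * q)) * (ladder y r - ladder y (r / q)) * ladder x r
      + (ladder y r - ladder y (r * q)) * splitCoeff q T x y (z * T) r
      + (ladder y r - ladder y (r / q)) * splitCoeff q T x y (z * T) (r * q) := by
    field_simp
    ring
  rw [e]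
  unfold ladder splitCoeff
  field_simp
  ring

/-- With `r = q ^ k`, this and `split_consistency` balance the coefficients of `W_{k+1}` and `W_k`
when the cubic relation in `C, C, B` is applied to `W_k`. -/
theorem split_recurrence (hq : q ≠ 0) (hT : T ≠ 0) (hx : x ≠ 0) (hy : y ≠ 0) (hz : z ≠ 0)
    (hr : r ≠ 0) :
    splitCoeff q T z y (x * T) r - (q ^ 2 + (q ^ 2)⁻¹) * splitCoeff q T z y (x * T) (r * q)
      + splitCoeff q T z y (x * T) (r * q ^ 2)
      + (ladder y r + ladder y (r * q)) * (ladder z r + ladder z (r * q))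
      - (q ^ 2 + (q ^ 2)⁻¹) * (ladder y (r * q) * ladder z (r * q) + ladder y r * ladder z r) =
    -(q - q⁻¹) ^ 2 * ((y * T + (y * T)⁻¹) * (z * T + (z * T)⁻¹)
        - (x * T + (x * T)⁻¹) * (q * T + (q * T)⁻¹)) := by
  unfold ladder splitCoeff
  field_simp
  ring

theorem split_consistency (hq : q ≠ 0) (hT : T ≠ 0) (hx : x ≠ 0) (hy : y ≠ 0) (hz : z ≠ 0)
    (hr : r ≠ 0) :
    (2 - (q ^ 2 + (q ^ 2)⁻¹)) * ladder z r ^ 2 * ladder y r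
      + splitCoeff q T z y (x * T) r * (ladder z r - ladder z (r * q))
      + splitCoeff q T z y (x * T) (r * q) * (ladder z r - ladder z (r / q))
      + (q ^ 2 - (q ^ 2)⁻¹) ^ 2 * ladder y r
      + (q - q⁻¹) ^ 2 * ((y * T + (y * T)⁻¹) * (z * T + (z * T)⁻¹)
        - (x * T + (x * T)⁻¹) * (q * T + (q * T)⁻¹)) * ladder z r
      + (q ^ 2 - (q ^ 2)⁻¹) * (q - q⁻¹) * ((x * T + (x * T)⁻¹) * (z * T + (z * T)⁻¹)
        - (y * T + (y * T)⁻¹) * (q * T + (q * T)⁻¹)) = 0 := by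
  unfold ladder splitCoeff
  field_simp
  ring

theorem split_initial (hq : q ≠ 0) (hT : T ≠ 0) (hx : x ≠ 0) (hy : y ≠ 0) (hz : z ≠ 0)
    (hq2 : q ^ 2 + 1 ≠ 0) (h : ladder y q - ladder y 1 ≠ 0) :
    (ladder y 1 - ladder y q) * ((q + q⁻¹)⁻¹ * (ladder y 1 *
        (ladder x 1 - splitCoeff q T x y (z * T) q / (ladder y q - ladder y 1))
        + ((z * T + (z * T)⁻¹) * (q * T + (q * T)⁻¹)
        - (x * T + (x * T)⁻¹) * (y * T + (y * T)⁻¹))) - ladder z 1) =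
      splitCoeff q T z y (x * T) q := by
  have e : (ladder y 1 - ladder y q) * ((q + q⁻¹)⁻¹ * (ladder y 1 *
        (ladder x 1 - splitCoeff q T x y (z * T) q / (ladder y q - ladder y 1))
        + ((z * T + (z * T)⁻¹) * (q * T + (q * T)⁻¹)
        - (x * T + (x * T)⁻¹) * (y * T + (y * T)⁻¹))) - ladder z 1) =
      (ladder y 1 - ladder y q) * ((q + q⁻¹)⁻¹ * (ladder y 1 * ladder x 1
        + ((z * T + (z * T)⁻¹) * (q * T + (q * T)⁻¹)
        - (x * T + (x * T)⁻¹) * (y * T + (y * T)⁻¹))) - ladder z 1)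
      + (q + q⁻¹)⁻¹ * ladder y 1 * splitCoeff q T x y (z * T) q := by
    generalize (q + q⁻¹)⁻¹ = i
    field_simp
    ring
  rw [e]
  have hq3 : q + q⁻¹ = (q ^ 2 + 1) / q := by field_simp
  rw [hq3]
  unfold ladder splitCoeff
  field_simp
  ring

end Scalars

/-! ### Cyclic relations and the split form -/

section Operators

open Polynomial

variable {V : Type*} [AddCommGroup V] [Module ℂ V]

/-- Apply the cubic relation to `w₁`: the term `B C C w₁` contains `B w₃`, and every other term is
known. The hypotheses `e₃, e₂, e₁, e₀` match the coefficients of `w₃, w₂, w₁, w₀`. The factor `f₁`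
in `h₀` allows the first step, where there is no predecessor `w₀` but `f₁ = 0`. -/
theorem split_step {B C : Module.End ℂ V} {β k₀ k₁ k₂ z₀ z₁ z₂ t₁ t₂ t₃ f₁ f₂ f₃ : ℂ}
    (hrel : C * C * B - β • (C * B * C) + B * C * C = k₀ • B + k₁ • C + k₂ • 1)
    {w₀ w₁ w₂ w₃ : V} (h₀ : f₁ • C w₀ = f₁ • (w₁ + z₀ • w₀)) (h₁ : C w₁ = w₂ + z₁ • w₁)
    (h₂ : C w₂ = w₃ + z₂ • w₂) (hB₁ : B w₁ = t₁ • w₁ + f₁ • w₀) (hB₂ : B w₂ = t₂ • w₂ + f₂ • w₁)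
    (e₃ : t₁ - β * t₂ + t₃ = 0)
    (e₂ : f₁ - β * f₂ + f₃ + (t₁ + t₂) * (z₁ + z₂) - β * (t₂ * z₂ + t₁ * z₁) = k₁)
    (e₁ : (2 - β) * z₁ ^ 2 * t₁ + f₁ * (z₀ + z₁ - β * z₁) + f₂ * (z₁ + z₂ - β * z₁)
      - k₀ * t₁ - k₁ * z₁ - k₂ = 0)
    (e₀ : z₀ ^ 2 - β * z₁ * z₀ + z₁ ^ 2 - k₀ = 0) :
    B w₃ = t₃ • w₃ + f₃ • w₂ := by
  have h₀' : C (C (f₁ • w₀)) = f₁ • w₂ + (f₁ * (z₁ + z₀)) • w₁ + (f₁ * z₀ ^ 2) • w₀ := by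
    rw [map_smul, h₀, map_smul, map_add, map_smul, h₁, smul_add, smul_comm f₁ z₀, h₀]
    module
  have h := congrArg (fun f : Module.End ℂ V => f w₁) hrel
  simp only [LinearMap.add_apply, LinearMap.sub_apply, LinearMap.smul_apply, Module.End.mul_apply,
    Module.End.one_apply] at h
  have hBCC : B (C (C w₁)) = B w₃ + (z₂ + z₁) • B w₂ + (z₁ ^ 2) • B w₁ := by
    rw [h₁, map_add, map_smul, h₂, h₁]
    simp only [map_add, map_smul]
    module
  have hCBC : C (B (C w₁)) = t₂ • C w₂ + (f₂ + z₁ * t₁) • C w₁ + z₁ • (f₁ • C w₀) := by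
    conv_lhs => rw [h₁, map_add, map_smul, hB₁, hB₂]
    simp only [map_add, map_smul]
    module
  have hCCB : C (C (B w₁)) = t₁ • (w₃ + (z₂ + z₁) • w₂ + (z₁ ^ 2) • w₁) +
      (f₁ • w₂ + (f₁ * (z₁ + z₀)) • w₁ + (f₁ * z₀ ^ 2) • w₀) := by
    rw [hB₁, map_add, map_add, h₀', map_smul, map_smul, h₁, map_add, map_smul, h₂, h₁]
    module
  rw [hBCC, hCBC, hCCB, h₀, h₁, h₂, hB₁, hB₂] at h
  have e₃' : t₃ = β * t₂ - t₁ := by linear_combination e₃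
  have e₂' : f₃ = k₁ - (f₁ - β * f₂ + (t₁ + t₂) * (z₁ + z₂) - β * (t₂ * z₂ + t₁ * z₁)) := by
    linear_combination e₂
  have e₁' : k₂ = (2 - β) * z₁ ^ 2 * t₁ + f₁ * (z₀ + z₁ - β * z₁) + f₂ * (z₁ + z₂ - β * z₁)
      - k₀ * t₁ - k₁ * z₁ := by linear_combination -e₁
  have e₀' : k₀ = z₀ ^ 2 - β * z₁ * z₀ + z₁ ^ 2 := by linear_combination -e₀
  rw [e₁'] at h
  rw [e₃', e₂']
  rw [e₀'] at h
  linear_combination (norm := module) h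

/-- The vectors `∏_{i < k} (C - z i) w`. -/
def splitVec (C : Module.End ℂ V) (z : ℕ → ℂ) (w : V) (k : ℕ) : V :=
  aeval C (∏ i ∈ Finset.range k, (X - Polynomial.C (z i))) w

theorem splitVec_zero (C : Module.End ℂ V) (z : ℕ → ℂ) (w : V) : splitVec C z w 0 = w := by
  simp [splitVec]

theorem apply_splitVec (C : Module.End ℂ V) (z : ℕ → ℂ) (w : V) (k : ℕ) :
    C (splitVec C z w k) = splitVec C z w (k + 1) + z k • splitVec C z w k := by
  rw [splitVec, splitVec, Finset.prod_range_succ_comm, map_mul]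
  simp [Algebra.algebraMap_eq_smul_one]

theorem aeval_splitVec_eq_zero {C : Module.End ℂ V} {z : ℕ → ℂ} {w : V} {n : ℕ}
    (h : splitVec C z w n = 0) (k : ℕ) :
    aeval C (∏ i ∈ Finset.range n, (X - Polynomial.C (z i))) (splitVec C z w k) = 0 := by
  rw [splitVec, ← Module.End.mul_apply, ← map_mul, mul_comm, map_mul, Module.End.mul_apply]
  rw [splitVec] at h
  rw [h, map_zero]

/-- The three defining relations of the Askey-Wilson algebra in cyclic form, for operators
normalised so that the eigenvalue sequences are `ladder x`, `ladder y` and `ladder z`;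
here `T = q ^ N`. -/
structure CyclicRelations (q T x y z : ℂ) (A B C : Module.End ℂ V) : Prop where
  relA : (q ^ 2 - (q ^ 2)⁻¹) • A = q • (C * B) - q⁻¹ • (B * C)
    - ((q - q⁻¹) * ((y * T + (y * T)⁻¹) * (z * T + (z * T)⁻¹)
      - (x * T + (x * T)⁻¹) * (q * T + (q * T)⁻¹))) • (1 : Module.End ℂ V)
  relB : (q ^ 2 - (q ^ 2)⁻¹) • B = q • (A * C) - q⁻¹ • (C * A)
    - ((q - q⁻¹) * ((x * T + (x * T)⁻¹) * (z * T + (z * T)⁻¹)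
      - (y * T + (y * T)⁻¹) * (q * T + (q * T)⁻¹))) • (1 : Module.End ℂ V)
  relC : (q ^ 2 - (q ^ 2)⁻¹) • C = q • (B * A) - q⁻¹ • (A * B)
    + ((q - q⁻¹) * ((z * T + (z * T)⁻¹) * (q * T + (q * T)⁻¹)
      - (x * T + (x * T)⁻¹) * (y * T + (y * T)⁻¹))) • (1 : Module.End ℂ V)

namespace CyclicRelations

variable {q T x y z : ℂ} {A B C : Module.End ℂ V}

/-- Eliminate `C`: take the `q`-commutator of `relC` with `B` and substitute `relA`. -/
theorem cubic_BA (h : CyclicRelations q T x y z A B C) (hq : q ≠ 0) :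
    B * B * A - (q ^ 2 + (q ^ 2)⁻¹) • (B * A * B) + A * B * B =
      (-(q ^ 2 - (q ^ 2)⁻¹) ^ 2) • A
      + ((q - q⁻¹) ^ 2 * ((z * T + (z * T)⁻¹) * (q * T + (q * T)⁻¹)
        - (x * T + (x * T)⁻¹) * (y * T + (y * T)⁻¹))) • B
      - ((q ^ 2 - (q ^ 2)⁻¹) * (q - q⁻¹) * ((y * T + (y * T)⁻¹) * (z * T + (z * T)⁻¹)
        - (x * T + (x * T)⁻¹) * (q * T + (q * T)⁻¹))) • 1 := by
  have h₁ := congrArg (fun f => (q ^ 2 - (q ^ 2)⁻¹) • f) h.relA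
  have h₂ := congrArg (fun f => q • (f * B) - q⁻¹ • (B * f)) h.relC
  generalize z * T + (z * T)⁻¹ = Z at *
  generalize x * T + (x * T)⁻¹ = X at *
  generalize y * T + (y * T)⁻¹ = Y at *
  generalize q * T + (q * T)⁻¹ = Q at *
  simp only [smul_mul_assoc, mul_smul_comm, mul_add, add_mul, mul_sub, sub_mul, mul_one, one_mul,
    smul_sub, smul_add, ← mul_assoc] at h₁ h₂ ⊢
  linear_combination (norm := skip) h₁ + h₂
  match_scalars <;> field_simp <;> ring

theorem cubic_CB (h : CyclicRelations q T x y z A B C) (hq : q ≠ 0) :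
    C * C * B - (q ^ 2 + (q ^ 2)⁻¹) • (C * B * C) + B * C * C =
      (-(q ^ 2 - (q ^ 2)⁻¹) ^ 2) • B
      + (-(q - q⁻¹) ^ 2 * ((y * T + (y * T)⁻¹) * (z * T + (z * T)⁻¹)
        - (x * T + (x * T)⁻¹) * (q * T + (q * T)⁻¹))) • C
      + (-((q ^ 2 - (q ^ 2)⁻¹) * (q - q⁻¹) * ((x * T + (x * T)⁻¹) * (z * T + (z * T)⁻¹)
        - (y * T + (y * T)⁻¹) * (q * T + (q * T)⁻¹)))) • 1 := by
  have h₁ := congrArg (fun f => (q ^ 2 - (q ^ 2)⁻¹) • f) h.relB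
  have h₂ := congrArg (fun f => q • (f * C) - q⁻¹ • (C * f)) h.relA
  generalize z * T + (z * T)⁻¹ = Z at *
  generalize x * T + (x * T)⁻¹ = X at *
  generalize y * T + (y * T)⁻¹ = Y at *
  generalize q * T + (q * T)⁻¹ = Q at *
  simp only [smul_mul_assoc, mul_smul_comm, mul_sub, sub_mul, mul_one, one_mul, smul_sub,
    ← mul_assoc] at h₁ h₂ ⊢
  linear_combination (norm := skip) h₁ + h₂
  match_scalars <;> field_simp <;> ring

/-- Converse elimination: `hC` serves as the definition of `C`, and each cubic relation is then a
`q`-commutator with `C`, from which the factor `q² - q⁻²` cancels. -/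
theorem of_cubic (hq : q ≠ 0) (hκ : q ^ 2 - (q ^ 2)⁻¹ ≠ 0)
    (hBA : B * B * A - (q ^ 2 + (q ^ 2)⁻¹) • (B * A * B) + A * B * B =
      (-(q ^ 2 - (q ^ 2)⁻¹) ^ 2) • A
      + ((q - q⁻¹) ^ 2 * ((z * T + (z * T)⁻¹) * (q * T + (q * T)⁻¹)
        - (x * T + (x * T)⁻¹) * (y * T + (y * T)⁻¹))) • B
      - ((q ^ 2 - (q ^ 2)⁻¹) * (q - q⁻¹) * ((y * T + (y * T)⁻¹) * (z * T + (z * T)⁻¹)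
        - (x * T + (x * T)⁻¹) * (q * T + (q * T)⁻¹))) • 1)
    (hAB : A * A * B - (q ^ 2 + (q ^ 2)⁻¹) • (A * B * A) + B * A * A =
      (-(q ^ 2 - (q ^ 2)⁻¹) ^ 2) • B
      + ((q - q⁻¹) ^ 2 * ((z * T + (z * T)⁻¹) * (q * T + (q * T)⁻¹)
        - (x * T + (x * T)⁻¹) * (y * T + (y * T)⁻¹))) • A
      - ((q ^ 2 - (q ^ 2)⁻¹) * (q - q⁻¹) * ((x * T + (x * T)⁻¹) * (z * T + (z * T)⁻¹)
        - (y * T + (y * T)⁻¹) * (q * T + (q * T)⁻¹))) • 1)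
    (hC : (q ^ 2 - (q ^ 2)⁻¹) • C = q • (B * A) - q⁻¹ • (A * B)
      + ((q - q⁻¹) * ((z * T + (z * T)⁻¹) * (q * T + (q * T)⁻¹)
        - (x * T + (x * T)⁻¹) * (y * T + (y * T)⁻¹))) • (1 : Module.End ℂ V)) :
    CyclicRelations q T x y z A B C := by
  refine ⟨?_, ?_, hC⟩
  · apply smul_right_injective _ hκ
    have h := congrArg (fun f => q • (f * B) - q⁻¹ • (B * f)) hC
    generalize z * T + (z * T)⁻¹ = Z at *
    generalize x * T + (x * T)⁻¹ = X at *
    generalize y * T + (y * T)⁻¹ = Y at *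
    generalize q * T + (q * T)⁻¹ = Q at *
    simp only [smul_mul_assoc, mul_smul_comm, mul_add, add_mul, mul_sub, sub_mul, mul_one,
      one_mul, smul_sub, smul_add, ← mul_assoc] at h hBA ⊢
    linear_combination (norm := skip) hBA - h
    match_scalars <;> field_simp <;> ring
  · apply smul_right_injective _ hκ
    have h := congrArg (fun f => q • (A * f) - q⁻¹ • (f * A)) hC
    generalize z * T + (z * T)⁻¹ = Z at *
    generalize x * T + (x * T)⁻¹ = X at *
    generalize y * T + (y * T)⁻¹ = Y at *
    generalize q * T + (q * T)⁻¹ = Q at *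
    simp only [smul_mul_assoc, mul_smul_comm, mul_add, add_mul, mul_sub, sub_mul, mul_one,
      one_mul, smul_sub, smul_add, ← mul_assoc] at h hAB ⊢
    linear_combination (norm := skip) hAB - h
    match_scalars <;> field_simp <;> ring

/-- The split form of the pair `(C, B)`. -/
theorem split_form (h : CyclicRelations q T x y z A B C) (hq : q ≠ 0) (hT : T ≠ 0) (hx : x ≠ 0)
    (hy : y ≠ 0) (hz : z ≠ 0) {w : V} (h₀ : B w = ladder y 1 • w)
    (h₁ : B (C w - ladder z 1 • w) = ladder y q • (C w - ladder z 1 • w)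
      + splitCoeff q T z y (x * T) q • w) (k : ℕ) :
    B (splitVec C (fun i => ladder z (q ^ i)) w k) =
      ladder y (q ^ k) • splitVec C (fun i => ladder z (q ^ i)) w k +
      splitCoeff q T z y (x * T) (q ^ k) • splitVec C (fun i => ladder z (q ^ i)) w (k - 1) := by
  set W := splitVec C (fun i => ladder z (q ^ i)) w with hW
  have hC : ∀ k, C (W k) = W (k + 1) + ladder z (q ^ k) • W k :=
    fun k => apply_splitVec C (fun i => ladder z (q ^ i)) w k
  have hW₀ : W 0 = w := splitVec_zero _ _ _
  have hW₁ : W 1 = C w - ladder z 1 • w := by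
    have := hC 0
    rw [hW₀, pow_zero] at this
    rw [this]; simp
  induction k using Nat.strong_induction_on with
  | _ k ih =>
    match k with
    | 0 => rw [pow_zero, splitCoeff_one, zero_smul, add_zero, hW₀, h₀]
    | 1 => simp only [pow_one, Nat.sub_self, hW₀, hW₁, h₁]
    | k + 2 =>
      have hr : q ^ k ≠ 0 := pow_ne_zero _ hq
      have i₁ := ih k (by omega)
      have i₂ := ih (k + 1) (by omega)
      have c₂ := hC (k + 1)
      simp only [Nat.add_sub_cancel, Nat.add_succ_sub_one, pow_add, pow_one] at i₂ c₂ ⊢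
      refine split_step (z₀ := ladder z (q ^ k / q)) (h.cubic_CB hq) ?_ (hC k) c₂ i₁ i₂
        (ladder_recurrence hq hy hr) (split_recurrence hq hT hx hy hz hr) ?_ ?_
      -- At `k = 0` the truncated `k - 1` names `W₀` itself, harmlessly because the coefficient is
      -- zero.
      · rcases k with _ | j
        · rw [pow_zero, splitCoeff_one, zero_smul, zero_smul]
        · have hj := hC j
          rw [Nat.add_sub_cancel, hj, pow_succ, mul_div_cancel_right₀ _ hq]
      · have e := split_consistency hq hT hx hy hz hr
        have e' := ladder_recurrence hq hz (div_ne_zero hr hq)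
        rw [div_mul_cancel₀ _ hq, show q ^ k / q * q ^ 2 = q ^ k * q by field_simp] at e'
        linear_combination e + (splitCoeff q T z y (x * T) (q ^ k)
          + splitCoeff q T z y (x * T) (q ^ k * q)) * e'
      · linear_combination ladder_consecutive hq hz hr

end CyclicRelations

end Operators

/-! ### Eigenbasis of `B` and the annihilating polynomial of `C` -/

section Operators

open Polynomial

variable {V : Type*} [AddCommGroup V] [Module ℂ V]

theorem repr_apply_of_eigenbasis {ι : Type*} (f : Module.Basis ι ℂ V) {B : Module.End ℂ V}
    {t : ι → ℂ} (hf : ∀ i, B (f i) = t i • f i) (w : V) (j : ι) :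
    f.repr (B w) j = t j * f.repr w j := by
  have : (f.coord j).comp B = t j • f.coord j := by
    refine f.ext fun i => ?_
    by_cases hij : i = j
    · subst hij; simp [hf]
    · simp [hf, hij]
  exact LinearMap.congr_fun this w

theorem eq_zero_of_eigenbasis {ι : Type*} (f : Module.Basis ι ℂ V) {B : Module.End ℂ V}
    {t : ι → ℂ} (hf : ∀ i, B (f i) = t i • f i) {s : ℂ} (hs : ∀ i, s ≠ t i) {w : V}
    (hw : B w = s • w) : w = 0 := by
  refine f.ext_elem fun j => ?_
  have h := repr_apply_of_eigenbasis f hf w j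
  rw [hw, map_smul, Finsupp.smul_apply, smul_eq_mul] at h
  have : (s - t j) * f.repr w j = 0 := by linear_combination h
  simpa [sub_ne_zero.mpr (hs j)] using this

theorem ladder_pow_eq_iff {q y : ℂ} (hq : q ≠ 0) (hroot : ∀ n : ℕ, 0 < n → q ^ n ≠ 1) (hy : y ≠ 0)
    {i j : ℕ} (hij : i ≠ j) :
    ladder y (q ^ i) = ladder y (q ^ j) ↔ y ^ 2 * (q ^ i) ^ 2 * (q ^ j) ^ 2 = 1 := by
  have hi : q ^ i ≠ 0 := pow_ne_zero _ hq
  have hj : q ^ j ≠ 0 := pow_ne_zero _ hq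
  rw [← sub_eq_zero, ladder_sub hy hi hj, div_eq_zero_iff, or_iff_left (by positivity),
    mul_eq_zero, sub_eq_zero, sub_eq_zero, or_iff_right]
  intro h
  rw [← pow_mul, ← pow_mul] at h
  rcases Nat.lt_or_gt_of_ne hij with hlt | hlt
  · refine hroot (j * 2 - i * 2) (by omega) (mul_left_cancel₀ (pow_ne_zero (i * 2) hq) ?_)
    rw [← pow_add, mul_one, h]; congr 1; omega
  · refine hroot (i * 2 - j * 2) (by omega) (mul_left_cancel₀ (pow_ne_zero (j * 2) hq) ?_)
    rw [← pow_add, mul_one, ← h]; congr 1; omega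

namespace CyclicRelations

variable {q x y z : ℂ} {N : ℕ} {A B C : Module.End ℂ V}

/-- Take matrix entries of the cubic relation in `B, B, A`: since `B` is diagonal, each entry of `A`
is multiplied by a quadratic in the eigenvalues, which `ladder_quadratic` factors. -/
theorem entry_eq {T : ℂ} (h : CyclicRelations q T x y z A B C) (hq : q ≠ 0) (hy : y ≠ 0)
    (f : Module.Basis (Fin (N + 1)) ℂ V) (hf : ∀ i, B (f i) = ladder y (q ^ (i : ℕ)) • f i)
    (i j : Fin (N + 1)) :
    (ladder y (q ^ (j : ℕ)) - ladder y (q ^ (i : ℕ) * q)) *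
      (ladder y (q ^ (j : ℕ)) - ladder y (q ^ (i : ℕ) / q)) * f.repr (A (f i)) j =
      ((q - q⁻¹) ^ 2 * ((z * T + (z * T)⁻¹) * (q * T + (q * T)⁻¹)
        - (x * T + (x * T)⁻¹) * (y * T + (y * T)⁻¹)) * ladder y (q ^ (i : ℕ))
      - (q ^ 2 - (q ^ 2)⁻¹) * (q - q⁻¹) * ((y * T + (y * T)⁻¹) * (z * T + (z * T)⁻¹)
        - (x * T + (x * T)⁻¹) * (q * T + (q * T)⁻¹))) * f.repr (f i) j := by
  have e := congrArg (fun g : Module.End ℂ V => f.repr (g (f i)) j) (h.cubic_BA hq)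
  simp only [LinearMap.add_apply, LinearMap.sub_apply, LinearMap.smul_apply, Module.End.mul_apply,
    Module.End.one_apply, map_add, map_sub, map_smul, Finsupp.add_apply, Finsupp.sub_apply,
    Finsupp.smul_apply, smul_eq_mul, repr_apply_of_eigenbasis f hf, hf] at e
  rw [← ladder_quadratic hq hy (pow_ne_zero _ hq)]
  linear_combination e

/-- The relation at index `0` carries the factor `y_0 - y_{-1}`, which may vanish, so this entry
cannot be read off directly. The other diagonal entries are determined and telescope, and the known
trace supplies the missing one. -/
theorem first_diag_entry (h : CyclicRelations q (q ^ N) x y z A B C) (hq : q ≠ 0) (hx : x ≠ 0)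
    (hy : y ≠ 0) (hz : z ≠ 0)
    (f : Module.Basis (Fin (N + 1)) ℂ V) (hf : ∀ i, B (f i) = ladder y (q ^ (i : ℕ)) • f i)
    (hinj : ∀ i ≤ N + 1, ∀ j ≤ N + 1, i ≠ j → ladder y (q ^ i) ≠ ladder y (q ^ j))
    (htr : LinearMap.trace ℂ V A = ∑ i : Fin (N + 1), ladder x (q ^ (i : ℕ))) :
    f.repr (A (f 0)) 0 =
      ladder x 1 - splitCoeff q (q ^ N) x y (z * q ^ N) q / (ladder y q - ladder y 1) := by
  have hT : q ^ N ≠ 0 := pow_ne_zero _ hq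
  set t : ℕ → ℂ := fun k => splitCoeff q (q ^ N) x y (z * q ^ N) (q ^ (k + 1)) /
    (ladder y (q ^ (k + 1)) - ladder y (q ^ k)) with ht
  have hdiag : ∀ i : Fin N, f.repr (A (f i.succ)) i.succ =
      ladder x (q ^ ((i : ℕ) + 1)) + (t i - t (i + 1)) := by
    intro i
    have e := h.entry_eq hq hy f hf i.succ i.succ
    simp only [Fin.val_succ, Module.Basis.repr_self, Finsupp.single_eq_same, mul_one] at e
    have hr : q ^ ((i : ℕ) + 1) ≠ 0 := pow_ne_zero _ hq
    have hd : q ^ ((i : ℕ) + 1) / q = q ^ (i : ℕ) := by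
      rw [pow_succ, mul_div_cancel_right₀ _ hq]
    have := diag_entry_eq hq hT hx hy hz hr
      (by rw [← pow_succ]; exact sub_ne_zero.mpr (hinj _ (by omega) _ (by omega) (by omega)))
      (by rw [hd]; exact sub_ne_zero.mpr (hinj _ (by omega) _ (by omega) (by omega))) e
    rw [this, hd, ← pow_succ, ht]
    ring
  rw [LinearMap.trace_eq_matrix_trace ℂ f, Matrix.trace, Fin.sum_univ_succ, Fin.sum_univ_succ]
    at htr
  simp only [Matrix.diag_apply, LinearMap.toMatrix_apply, hdiag, Finset.sum_add_distrib,
    Fin.val_succ, Fin.val_zero, pow_zero] at htr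
  rw [Fin.sum_univ_eq_sum_range (fun k => t k - t (k + 1)), Finset.sum_range_sub'] at htr
  have hN : t N = 0 := by
    simp only [ht]
    rw [pow_succ', splitCoeff_last, zero_div]
  have h0 : t 0 = splitCoeff q (q ^ N) x y (z * q ^ N) q / (ladder y q - ladder y 1) := by
    simp [ht]
  rw [← h0]
  linear_combination htr + hN

/-- The characteristic equation of `C`. -/
theorem aeval_prod_eq_zero (h : CyclicRelations q (q ^ N) x y z A B C) (hq : q ≠ 0)
    (hroot : ∀ n : ℕ, 0 < n → q ^ n ≠ 1) (hx : x ≠ 0) (hy : y ≠ 0) (hz : z ≠ 0)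
    (f : Module.Basis (Fin (N + 1)) ℂ V) (hf : ∀ i, B (f i) = ladder y (q ^ (i : ℕ)) • f i)
    (hinj : ∀ i ≤ N + 1, ∀ j ≤ N + 1, i ≠ j → ladder y (q ^ i) ≠ ladder y (q ^ j))
    (htr : LinearMap.trace ℂ V A = ∑ i : Fin (N + 1), ladder x (q ^ (i : ℕ)))
    (hirr : ∀ W : Submodule ℂ V, (∀ w ∈ W, A w ∈ W) → (∀ w ∈ W, B w ∈ W) → W = ⊥ ∨ W = ⊤) :
    aeval C (∏ i ∈ Finset.range (N + 1), (X - Polynomial.C (ladder z (q ^ i)))) = 0 := by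
  have hT : q ^ N ≠ 0 := pow_ne_zero _ hq
  have hκ : q ^ 2 - (q ^ 2)⁻¹ ≠ 0 := by
    intro h0
    refine hroot 4 (by norm_num) ?_
    field_simp at h0
    linear_combination h0
  have hq1 : q ^ 2 + 1 ≠ 0 := by
    intro h0
    exact hroot 4 (by norm_num) (by linear_combination (q ^ 2 - 1) * h0)
  have ha := h.first_diag_entry hq hx hy hz f hf hinj htr
  have h₀ : B (f 0) = ladder y 1 • f 0 := by simpa using hf 0
  set v : V := A (f 0) - f.repr (A (f 0)) 0 • f 0 with hv
  have hBv : B v = ladder y q • v := by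
    refine f.ext_elem fun j => ?_
    rw [repr_apply_of_eigenbasis f hf, map_smul, Finsupp.smul_apply, smul_eq_mul]
    by_cases hj : j = 0
    · subst hj; simp [hv]
    · have e := h.entry_eq hq hy f hf 0 j
      have hj' : (0 : Fin (N + 1)) ≠ j := Ne.symm hj
      have hvj : f.repr v j = f.repr (A (f 0)) j := by simp [hv, hj']
      rw [Module.Basis.repr_self, Finsupp.single_eq_of_ne hj, mul_zero, mul_eq_zero, mul_eq_zero,
        sub_eq_zero, sub_eq_zero, Fin.val_zero, pow_zero, one_mul, one_div] at e
      rw [hvj]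
      rcases e with (e | e) | e
      · rw [e]
      -- The root `y_j = y_{-1}`: as `q` is not a root of unity, it forces `y² q^{2(j-1)} = 1`. For
      -- `j ≥ 2` this would give `y_{j-1} = y_0`; for `j = 1` the eigenvalue is already the desired
      -- `y_1`.
      · obtain ⟨k, hk⟩ : ∃ k, (j : ℕ) = k + 1 :=
          Nat.exists_eq_succ_of_ne_zero (fun h0 => hj (Fin.ext h0))
        have hjN := j.isLt
        rcases Nat.eq_zero_or_pos k with hk0 | hk0
        · rw [hk, hk0]; simp
        · exfalso
          refine hinj 0 (by omega) k (by omega) (by omega) ?_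
          rw [ladder_pow_eq_iff hq hroot hy (by omega)]
          rw [← sub_eq_zero, ladder_sub hy (pow_ne_zero _ hq) (inv_ne_zero hq), div_eq_zero_iff,
            or_iff_left (by positivity), mul_eq_zero, sub_eq_zero, sub_eq_zero] at e
          rcases e with e | e
          · exfalso
            refine hroot ((j + 1) * 2) (by omega) ?_
            rw [pow_mul, pow_succ q, mul_pow, e, inv_pow, inv_mul_cancel₀ (pow_ne_zero _ hq)]
          · rw [← e, hk]
            field_simp
            ring
      · rw [e, mul_zero, mul_zero]
  have hAf : A (f 0) = f.repr (A (f 0)) 0 • f 0 + v := by rw [hv]; abel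
  set a := f.repr (A (f 0)) 0 with ha'
  set G := (z * q ^ N + (z * q ^ N)⁻¹) * (q * q ^ N + (q * q ^ N)⁻¹)
        - (x * q ^ N + (x * q ^ N)⁻¹) * (y * q ^ N + (y * q ^ N)⁻¹) with hG
  have hCf : C (f 0) = ((q + q⁻¹)⁻¹ * (ladder y 1 * a + G)) • f 0
      + ((q ^ 2 - (q ^ 2)⁻¹)⁻¹ * (q * ladder y q - q⁻¹ * ladder y 1)) • v := by
    have e := LinearMap.congr_fun h.relC (f 0)
    simp only [LinearMap.add_apply, LinearMap.sub_apply, LinearMap.smul_apply,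
      Module.End.mul_apply, Module.End.one_apply, h₀, hAf, map_add, map_smul, hBv, ← hG] at e
    rw [← inv_smul_smul₀ hκ (C (f 0)), e]
    have hq3 : q + q⁻¹ ≠ 0 := by
      rw [show q + q⁻¹ = (q ^ 2 + 1) / q by field_simp]
      exact div_ne_zero hq1 hq
    have hq4 : q - q⁻¹ ≠ 0 := by
      intro h0
      exact hκ (by rw [show q ^ 2 - (q ^ 2)⁻¹ = (q - q⁻¹) * (q + q⁻¹) by field_simp; ring, h0,
        zero_mul])
    rw [show q ^ 2 - (q ^ 2)⁻¹ = (q - q⁻¹) * (q + q⁻¹) by field_simp; ring, mul_inv]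
    generalize q + q⁻¹ = s at *
    have : (q - q⁻¹)⁻¹ * (q - q⁻¹) = 1 := inv_mul_cancel₀ hq4
    match_scalars
    · linear_combination (s⁻¹ * (ladder y 1 * a + G)) * this
    · ring
  have hsplit := h.split_form hq hT hx hy hz h₀ (by
    rw [← split_initial hq hT hx hy hz hq1 (sub_ne_zero.mpr (by
      simpa using hinj 1 (by omega) 0 (by omega) (by omega))), ← ha, ← hG, hCf]
    simp only [map_add, map_sub, map_smul, h₀, hBv]
    module)
  -- `W_{N+1}` satisfies the eigenvalue equation of `B` for `y_{N+1}`, which lies outside the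
  -- spectrum.
  have hlast : splitVec C (fun i => ladder z (q ^ i)) (f 0) (N + 1) = 0 := by
    refine eq_zero_of_eigenbasis f hf (s := ladder y (q ^ (N + 1)))
      (fun i => hinj _ le_rfl _ (by omega) (by omega)) ?_
    rw [hsplit, pow_succ', splitCoeff_last, zero_smul, add_zero]
  set W : Submodule ℂ V :=
    Submodule.span ℂ (Set.range (splitVec C (fun i => ladder z (q ^ i)) (f 0))) with hW
  have hmem : ∀ k, splitVec C (fun i => ladder z (q ^ i)) (f 0) k ∈ W :=
    fun k => Submodule.subset_span ⟨k, rfl⟩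
  have hWB : ∀ w ∈ W, B w ∈ W := by
    refine fun w hw => (Submodule.span_le (p := W.comap B)).mpr ?_ hw
    rintro _ ⟨k, rfl⟩
    simp only [Submodule.comap_coe, Set.mem_preimage, SetLike.mem_coe, hsplit]
    exact W.add_mem (W.smul_mem _ (hmem _)) (W.smul_mem _ (hmem _))
  have hWC : ∀ w ∈ W, C w ∈ W := by
    refine fun w hw => (Submodule.span_le (p := W.comap C)).mpr ?_ hw
    rintro _ ⟨k, rfl⟩
    simp only [Submodule.comap_coe, Set.mem_preimage, SetLike.mem_coe, apply_splitVec]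
    exact W.add_mem (hmem _) (W.smul_mem _ (hmem _))
  have hWA : ∀ w ∈ W, A w ∈ W := by
    intro w hw
    have e := LinearMap.congr_fun h.relA w
    simp only [LinearMap.sub_apply, LinearMap.smul_apply, Module.End.mul_apply,
      Module.End.one_apply] at e
    rw [← inv_smul_smul₀ hκ (A w), e]
    exact W.smul_mem _ (W.sub_mem (W.sub_mem (W.smul_mem _ (hWC _ (hWB _ hw)))
      (W.smul_mem _ (hWB _ (hWC _ hw)))) (W.smul_mem _ hw))
  have htop : W = ⊤ := by
    refine (hirr W hWA hWB).resolve_left fun h0 => f.ne_zero 0 ?_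
    have := hmem 0
    rwa [splitVec_zero, h0, Submodule.mem_bot] at this
  -- The product commutes with every polynomial in `C` and kills `f₀`, hence all the spanning
  -- vectors `W_k`.
  refine LinearMap.ext_on_range (htop ▸ hW).symm fun k => ?_
  rw [LinearMap.zero_apply]
  exact aeval_splitVec_eq_zero hlast k

end CyclicRelations

end Operators

/-! ### Lagrange interpolation -/

section Interpolation

open Polynomial

theorem prod_sub_X_mem_degreeLT {N : ℕ} (x : Fin N → ℂ) :
    ∏ j, (C (x j) - X) ∈ degreeLT ℂ (N + 1) := by
  rw [mem_degreeLT]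
  refine lt_of_le_of_lt (degree_prod_le _ _) ?_
  refine lt_of_le_of_lt (Finset.sum_le_card_nsmul _ _ 1 fun i _ => ?_) ?_
  · rw [← neg_sub, degree_neg, degree_X_sub_C]
  · simp only [Finset.card_univ, Fintype.card_fin, nsmul_eq_mul, mul_one]
    exact_mod_cast Nat.lt_succ_self N

/-- Lagrange interpolation of the product of `N + 1` linear factors modulo a monic polynomial of
degree `N + 1`, given by its roots. -/
theorem prod_sub_X_eq_interpolation {N : ℕ} (z : ℕ → ℂ) (x₀ : ℂ) (x : Fin N → ℂ)
    (h₀ : ∀ i, x i - x₀ ≠ 0) (h : ∀ i j, i ≠ j → x j - x i ≠ 0) :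
    (C x₀ - X) * ∏ i, (C (x i) - X) =
      C ((-1) ^ (N + 1)) * ∏ k ∈ Finset.range (N + 1), (X - C (z k))
      + C ((-1) ^ N * (∏ k ∈ Finset.range (N + 1), (x₀ - z k)) / ∏ i, (x i - x₀)) *
          ∏ i, (C (x i) - X)
      - ∑ i, C ((-1) ^ N * (∏ k ∈ Finset.range (N + 1), (x i - z k)) /
            ((x i - x₀) * ∏ j ∈ Finset.univ.erase i, (x j - x i))) *
          ∏ j, (C (Function.update x i x₀ j) - X) := by
  have hprod : ∀ a : ℂ, eval a (∏ k ∈ Finset.range (N + 1), (X - C (z k))) =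
      ∏ k ∈ Finset.range (N + 1), (a - z k) := fun a => by simp [eval_prod]
  have hzero : ∀ i, ∏ j, (x j - x i) = 0 := fun i =>
    Finset.prod_eq_zero (Finset.mem_univ i) (sub_self _)
  have hupd : ∀ i a, ∏ j, (Function.update x i x₀ j - a) =
      (x₀ - a) * ∏ j ∈ Finset.univ.erase i, (x j - a) := by
    intro i a
    rw [← Finset.mul_prod_erase _ _ (Finset.mem_univ i), Function.update_self]
    congr 1
    refine Finset.prod_congr rfl fun j hj => ?_
    rw [Function.update_of_ne (Finset.ne_of_mem_erase hj)]
  let node : Option (Fin N) → ℂ := fun o => o.elim x₀ x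
  have hnode : Function.Injective node := by
    rintro (_ | i) (_ | j) hij
    · rfl
    · exact absurd (sub_eq_zero.mpr (show x j = x₀ from hij.symm)) (h₀ j)
    · exact absurd (sub_eq_zero.mpr (show x i = x₀ from hij)) (h₀ i)
    · by_contra hne
      exact h i j (fun e => hne (by rw [e])) (sub_eq_zero.mpr (show x i = x j from hij).symm)
  refine eq_of_degree_sub_lt_of_eval_index_eq Finset.univ (v := node) hnode.injOn ?_ ?_
  · rw [Finset.card_univ, Fintype.card_option, Fintype.card_fin, ← mem_degreeLT]
    have hf : (C x₀ - X) * ∏ i, (C (x i) - X) =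
        C ((-1) ^ (N + 1)) * ∏ o, (X - C (node o)) := by
      rw [Fintype.prod_option]
      have : ∀ i, C (x i) - X = C (-1) * (X - C (x i)) := fun i => by simp
      simp only [this, Finset.prod_mul_distrib, Finset.prod_const, Finset.card_univ,
        Fintype.card_fin, node, Option.elim_none, Option.elim_some, C_pow]
      simp only [map_neg, map_one]
      ring
    -- The difference of the two monic polynomials has degree at most `N`, so the `N + 1` nodes
    -- determine everything.
    rw [hf, add_sub_assoc, ← sub_sub, ← mul_sub]
    refine Submodule.sub_mem _ ?_ (Submodule.sub_mem _ ?_ (Submodule.sum_mem _ fun i _ => ?_))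
    · rw [← smul_eq_C_mul]
      refine Submodule.smul_mem _ _ ?_
      rw [mem_degreeLT]
      have hm₁ : (∏ o, (X - C (node o))).Monic := monic_prod_of_monic _ _ fun _ _ => monic_X_sub_C _
      have hm₂ : (∏ k ∈ Finset.range (N + 1), (X - C (z k))).Monic :=
        monic_prod_of_monic _ _ fun _ _ => monic_X_sub_C _
      have hd₁ : (∏ o, (X - C (node o))).degree = ((N + 1 : ℕ) : WithBot ℕ) := by
        rw [degree_prod]; simp
      have hd₂ : (∏ k ∈ Finset.range (N + 1), (X - C (z k))).degree =
          ((N + 1 : ℕ) : WithBot ℕ) := by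
        rw [degree_prod]; simp
      rw [← hd₁]
      exact degree_sub_lt_left (hd₁.trans hd₂.symm) hm₁.ne_zero (by rw [hm₁, hm₂])
    · rw [← smul_eq_C_mul]
      exact Submodule.smul_mem _ _ (prod_sub_X_mem_degreeLT _)
    · rw [← smul_eq_C_mul]
      exact Submodule.smul_mem _ _ (prod_sub_X_mem_degreeLT _)
  · rintro (_ | i) -
    · simp only [node, Option.elim_none, eval_mul, eval_add, eval_sub, eval_C, eval_X, eval_prod,
        eval_finsetSum, sub_self, zero_mul, hupd, mul_zero, Finset.sum_const_zero]
      rw [div_mul_cancel₀ _ (Finset.prod_ne_zero_iff.mpr fun i _ => h₀ i)]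
      ring
    · simp only [node, Option.elim_some, eval_mul, eval_add, eval_sub, eval_C, eval_X, eval_prod,
        eval_finsetSum, hzero, hupd, mul_zero]
      rw [Finset.sum_eq_single i]
      · have hne : ∏ j ∈ Finset.univ.erase i, (x j - x i) ≠ 0 :=
          Finset.prod_ne_zero_iff.mpr fun j hj => h i j (Finset.ne_of_mem_erase hj).symm
        have := h₀ i
        field_simp
        ring
      · intro j _ hji
        have hvanish : ∏ l ∈ Finset.univ.erase j, (x l - x i) = 0 :=
          Finset.prod_eq_zero (Finset.mem_erase.mpr ⟨hji.symm, Finset.mem_univ i⟩) (sub_self _)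
        rw [hvanish, mul_zero, mul_zero]
      · intro hi
        exact absurd (Finset.mem_univ i) hi

end Interpolation

/-! ### Products of `b` as differences of spectral variables -/

section SpectralProducts

/-- The spectral variable `q u² + q⁻¹ u⁻²`. -/
def spectralVar (q u : ℂ) : ℂ := q * u ^ 2 + q⁻¹ * (u ^ 2)⁻¹

theorem bfun_mul_bfun {q u w : ℂ} (hq : q ≠ 0) (hu : u ≠ 0) (hw : w ≠ 0) :
    bfun (u * w⁻¹) * bfun (q⁻¹ * u⁻¹ * w⁻¹) = spectralVar q w - spectralVar q u := by
  unfold bfun spectralVar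
  field_simp
  ring

/-- Pair the factor with `v` at `k` with the factor with `v⁻¹` at `N - k`: their powers of `q`
multiply to `q`, so each pair is a difference of a spectral variable and a root `z_k`. -/
theorem prod_bfun_eq (P : Params) {u : ℂ} (hu : u ≠ 0) :
    ∏ k ∈ Finset.range (P.N + 1), (bfun (P.q ^ (1 / 2 + (k : ℂ) - P.s) * P.v * u) *
        bfun (P.q ^ (1 / 2 + (k : ℂ) - P.s) * P.v⁻¹ * u)) =
      ∏ k ∈ Finset.range (P.N + 1),
        (spectralVar P.q u - ladder (P.v ^ 2 * (P.q ^ P.N)⁻¹) (P.q ^ k)) := by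
  have hq := P.q_ne_zero
  have hv := P.v_ne_zero
  rw [Finset.prod_mul_distrib, ← Finset.prod_range_reflect
    (fun k : ℕ => bfun (P.q ^ (1 / 2 + (k : ℂ) - P.s) * P.v⁻¹ * u)), ← Finset.prod_mul_distrib]
  refine Finset.prod_congr rfl fun k hk => ?_
  have hkN : k ≤ P.N := Nat.lt_succ_iff.mp (Finset.mem_range.mp hk)
  set c := P.q ^ (1 / 2 + (k : ℂ) - P.s) with hc
  have hc0 : c ≠ 0 := by rw [hc, Complex.cpow_def_of_ne_zero hq]; exact Complex.exp_ne_zero _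
  have hc' : P.q ^ (1 / 2 + ((P.N + 1 - 1 - k : ℕ) : ℂ) - P.s) = P.q * c⁻¹ := by
    rw [hc, ← Complex.cpow_neg]
    nth_rewrite 2 [← Complex.cpow_one P.q]
    rw [← Complex.cpow_add _ _ hq, Nat.add_sub_cancel, Nat.cast_sub hkN]
    congr 1
    unfold Params.s
    ring
  have hc2 : c ^ 2 * P.q ^ P.N = P.q * (P.q ^ k) ^ 2 := by
    have : P.q * (P.q ^ k) ^ 2 = P.q ^ ((1 + k * 2 : ℕ) : ℂ) := by
      rw [Complex.cpow_natCast, pow_add, pow_mul, pow_one]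
    rw [this, hc, ← Complex.cpow_natCast P.q P.N, ← Complex.cpow_nat_mul,
      ← Complex.cpow_add _ _ hq]
    congr 1
    unfold Params.s
    push_cast
    ring
  have hT : P.q ^ P.N ≠ 0 := pow_ne_zero _ hq
  have hz : P.v ^ 2 * (P.q ^ P.N)⁻¹ * (P.q ^ k) ^ 2 = P.v ^ 2 * c ^ 2 * P.q⁻¹ := by
    field_simp
    linear_combination -hc2
  rw [hc', ladder, hz]
  unfold bfun spectralVar
  field_simp
  ring

end SpectralProducts

/-! ### Structure constants after rescaling the generators -/

namespace Params

variable (P : Params)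

/-- The overall scale `q ^ ((ν + ν') / 2)` of the generators. -/
def scale : ℂ := P.q ^ ((P.ν + P.ν') / 2)

theorem cpow_ne_zero (a : ℂ) : P.q ^ a ≠ 0 := by
  rw [Complex.cpow_def_of_ne_zero P.q_ne_zero]
  exact Complex.exp_ne_zero _

theorem scale_ne_zero : P.scale ≠ 0 := P.cpow_ne_zero _

theorem q_sq_sub_inv_ne_zero : P.q ^ 2 - (P.q ^ 2)⁻¹ ≠ 0 := by
  intro h
  have hq := P.q_ne_zero
  field_simp at h
  exact P.q_not_root 4 (by norm_num) (by linear_combination h)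

theorem q_sq_sub_inv_eq :
    P.q ^ 2 - (P.q ^ 2)⁻¹ = (P.q - P.q⁻¹) * (P.q + P.q⁻¹) := by
  have hq := P.q_ne_zero
  field_simp
  ring

theorem q_sub_inv_ne_zero : P.q - P.q⁻¹ ≠ 0 := fun h =>
  P.q_sq_sub_inv_ne_zero (by rw [q_sq_sub_inv_eq, h, zero_mul])

theorem q_add_inv_ne_zero : P.q + P.q⁻¹ ≠ 0 := fun h =>
  P.q_sq_sub_inv_ne_zero (by rw [q_sq_sub_inv_eq, h, mul_zero])

theorem χ_ne_zero : P.χ ≠ 0 :=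
  mul_ne_zero (mul_ne_zero (by norm_num) (P.cpow_ne_zero _)) P.q_sq_sub_inv_ne_zero

theorem cpow_eq_scale_sq : P.q ^ (P.ν + P.ν') = P.scale ^ 2 := by
  rw [scale, ← Complex.cpow_nat_mul]
  congr 1
  push_cast
  ring

theorem cpow_eq_scale_cube : P.q ^ (3 / 2 * (P.ν + P.ν')) = P.scale ^ 3 := by
  rw [scale, ← Complex.cpow_nat_mul]
  congr 1
  push_cast
  ring

theorem ρ_eq : P.ρ = -(P.scale / 2) ^ 2 * (P.q ^ 2 - (P.q ^ 2)⁻¹) ^ 2 := by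
  rw [ρ, cpow_eq_scale_sq]
  ring

theorem ω_eq : P.ω = (P.scale / 2) ^ 2 * ((P.q - P.q⁻¹) ^ 2 *
    ((P.v ^ 2 + (P.v ^ 2)⁻¹) * (P.q * P.q ^ P.N + (P.q * P.q ^ P.N)⁻¹)
      - 2 * Complex.cosh P.μ * (2 * Complex.cosh P.μ'))) := by
  rw [ω, cpow_eq_scale_sq, ← pow_succ']
  ring

theorem η_eq : P.η = -(P.scale / 2) ^ 3 * ((P.q ^ 2 - (P.q ^ 2)⁻¹) * (P.q - P.q⁻¹) *
    (2 * Complex.cosh P.μ * (P.v ^ 2 + (P.v ^ 2)⁻¹)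
      - 2 * Complex.cosh P.μ' * (P.q * P.q ^ P.N + (P.q * P.q ^ P.N)⁻¹))) := by
  rw [η, cpow_eq_scale_cube, ← pow_succ', sq (P.q ^ 2 - _)]
  nth_rewrite 1 [P.q_sq_sub_inv_eq]
  have := P.q_add_inv_ne_zero
  generalize P.q + P.q⁻¹ = s at *
  field_simp
  ring

theorem ηStar_eq : P.ηStar = -(P.scale / 2) ^ 3 * ((P.q ^ 2 - (P.q ^ 2)⁻¹) * (P.q - P.q⁻¹) *
    (2 * Complex.cosh P.μ' * (P.v ^ 2 + (P.v ^ 2)⁻¹)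
      - 2 * Complex.cosh P.μ * (P.q * P.q ^ P.N + (P.q * P.q ^ P.N)⁻¹))) := by
  rw [ηStar, cpow_eq_scale_cube, ← pow_succ', sq (P.q ^ 2 - _)]
  nth_rewrite 1 [P.q_sq_sub_inv_eq]
  have := P.q_add_inv_ne_zero
  generalize P.q + P.q⁻¹ = s at *
  field_simp
  ring

theorem θ_eq (M : ℕ) :
    P.θ M = P.scale / 2 * ladder (Complex.exp (-P.μ) * (P.q ^ P.N)⁻¹) (P.q ^ M) := by
  have hq := P.q_ne_zero
  rw [θ, b, c, ladder, ← scale, zpow_neg, zpow_natCast, zpow_neg,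
    show (2 * (M : ℤ)) = ((M * 2 : ℕ) : ℤ) by push_cast; ring, zpow_natCast, pow_mul,
    Complex.exp_neg]
  have := Complex.exp_ne_zero P.μ
  field_simp

theorem θStar_eq (M : ℕ) :
    P.θStar M = P.scale / 2 * ladder (Complex.exp P.μ' * (P.q ^ P.N)⁻¹) (P.q ^ M) := by
  have hq := P.q_ne_zero
  rw [θStar, bStar, cStar, ladder, ← scale, zpow_neg, zpow_natCast, zpow_neg,
    show (2 * (M : ℤ)) = ((M * 2 : ℕ) : ℤ) by push_cast; ring, zpow_natCast, pow_mul,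
    Complex.exp_neg]
  have := Complex.exp_ne_zero P.μ'
  field_simp

end Params

theorem genA_relation (P : Params) :
    qComm P.q⁻¹ (genA P) (qComm P.q (genA P) (genAStar P)) =
      P.ρ • genAStar P + P.ω • genA P + P.η • 1 := by
  simpa [qComm, genA, genAStar] using RingQuot.mkAlgHom_rel ℂ (Rel.aw1 (P := P))

theorem genAStar_relation (P : Params) :
    qComm P.q⁻¹ (genAStar P) (qComm P.q (genAStar P) (genA P)) =
      P.ρ • genA P + P.ω • genAStar P + P.ηStar • 1 := by
  simpa [qComm, genA, genAStar] using RingQuot.mkAlgHom_rel ℂ (Rel.aw2 (P := P))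

theorem submodule_invariant_of_generators {P : Params} {V : Type*} [AddCommGroup V] [Module ℂ V]
    (π : Alg P →ₐ[ℂ] Module.End ℂ V) {W : Submodule ℂ V} (hA : ∀ w ∈ W, π (genA P) w ∈ W)
    (hB : ∀ w ∈ W, π (genAStar P) w ∈ W) (a : Alg P) : ∀ w ∈ W, π a w ∈ W := by
  obtain ⟨a, rfl⟩ := RingQuot.mkAlgHom_surjective ℂ (Rel P) a
  induction a using FreeAlgebra.induction with
  | grade0 r =>
    intro w hw
    simpa [Algebra.algebraMap_eq_smul_one] using W.smul_mem r hw
  | grade1 g =>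
    cases g
    · exact hA
    · exact hB
  | mul a b ha hb =>
    intro w hw
    rw [map_mul, map_mul]
    exact ha _ (hb _ hw)
  | add a b ha hb =>
    intro w hw
    rw [map_add, map_add]
    exact W.add_mem (ha _ hw) (hb _ hw)

/-! ### The third operator in the given representation -/

namespace Rep

variable {P : Params} {V : Type*} [AddCommGroup V] [Module ℂ V] (R : Rep P V)

/-- The third operator of the Askey-Wilson triple, normalised so that its characteristic roots are
`v² q^{2k - 2s} + v⁻² q^{2s - 2k}`. -/
def third : Module.End ℂ V :=
  -((P.q ^ 2 - (P.q ^ 2)⁻¹) * P.ρ⁻¹) •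
    (qComm P.q (R.π (genAStar P)) (R.π (genA P)) + (P.ω / (P.q - P.q⁻¹)) • 1)

/-- The relations see `y` only through `y T + (y T)⁻¹ = 2 cosh μ'`. Leaving `y` free permits both
`e^{μ'} q^{-N}` and `e^{-μ'} q^{-N}`, that is, both orderings of the spectrum of `A*`. -/
theorem cyclicRelations {y : ℂ}
    (hy : y * P.q ^ P.N + (y * P.q ^ P.N)⁻¹ = 2 * Complex.cosh P.μ') :
    CyclicRelations P.q (P.q ^ P.N) (Complex.exp (-P.μ) * (P.q ^ P.N)⁻¹) y
      (P.v ^ 2 * (P.q ^ P.N)⁻¹) ((P.scale / 2)⁻¹ • R.π (genA P))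
      ((P.scale / 2)⁻¹ • R.π (genAStar P)) R.third := by
  have hq := P.q_ne_zero
  have hT : P.q ^ P.N ≠ 0 := pow_ne_zero _ hq
  have hp : P.scale / 2 ≠ 0 := div_ne_zero P.scale_ne_zero two_ne_zero
  have hκ := P.q_sq_sub_inv_ne_zero
  have hκ' := P.q_sub_inv_ne_zero
  have hx : Complex.exp (-P.μ) * (P.q ^ P.N)⁻¹ * P.q ^ P.N
      + (Complex.exp (-P.μ) * (P.q ^ P.N)⁻¹ * P.q ^ P.N)⁻¹ = 2 * Complex.cosh P.μ := by
    rw [inv_mul_cancel_right₀ hT, ← Complex.exp_neg, neg_neg, Complex.cosh]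
    ring
  have h₁ := congrArg R.π (genA_relation P)
  have h₂ := congrArg R.π (genAStar_relation P)
  simp only [qComm, map_sub, map_smul, map_mul, map_add, map_one, P.ρ_eq, P.ω_eq, P.η_eq,
    P.ηStar_eq] at h₁ h₂
  apply CyclicRelations.of_cubic hq hκ
  · rw [hx, hy, inv_mul_cancel_right₀ hT]
    have h := congrArg (fun f => ((P.scale / 2)⁻¹) ^ 3 • f) h₂
    generalize P.scale / 2 = p at *
    generalize P.v ^ 2 + (P.v ^ 2)⁻¹ = Z at *
    generalize 2 * Complex.cosh P.μ = X at *
    generalize 2 * Complex.cosh P.μ' = Y at *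
    generalize P.q * P.q ^ P.N + (P.q * P.q ^ P.N)⁻¹ = Q at *
    generalize R.π (genA P) = A at *
    generalize R.π (genAStar P) = B at *
    generalize P.q = q at *
    simp only [smul_mul_assoc, mul_smul_comm, mul_sub, sub_mul, smul_sub, smul_add,
      ← mul_assoc] at h ⊢
    linear_combination (norm := skip) h
    match_scalars <;> field_simp <;> ring
  · rw [hx, hy, inv_mul_cancel_right₀ hT]
    have h := congrArg (fun f => ((P.scale / 2)⁻¹) ^ 3 • f) h₁
    generalize P.scale / 2 = p at *
    generalize P.v ^ 2 + (P.v ^ 2)⁻¹ = Z at *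
    generalize 2 * Complex.cosh P.μ = X at *
    generalize 2 * Complex.cosh P.μ' = Y at *
    generalize P.q * P.q ^ P.N + (P.q * P.q ^ P.N)⁻¹ = Q at *
    generalize R.π (genA P) = A at *
    generalize R.π (genAStar P) = B at *
    generalize P.q = q at *
    simp only [smul_mul_assoc, mul_smul_comm, mul_sub, sub_mul, smul_sub, smul_add,
      ← mul_assoc] at h ⊢
    linear_combination (norm := skip) h
    match_scalars <;> field_simp <;> ring
  · rw [hx, hy, inv_mul_cancel_right₀ hT, third, P.ρ_eq, P.ω_eq, qComm]
    generalize P.scale / 2 = p at *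
    generalize P.v ^ 2 + (P.v ^ 2)⁻¹ = Z at *
    generalize 2 * Complex.cosh P.μ = X at *
    generalize 2 * Complex.cosh P.μ' = Y at *
    generalize P.q * P.q ^ P.N + (P.q * P.q ^ P.N)⁻¹ = Q at *
    generalize R.π (genA P) = A at *
    generalize R.π (genAStar P) = B at *
    generalize P.q ^ 2 - (P.q ^ 2)⁻¹ = κ at *
    generalize P.q - P.q⁻¹ = κ' at *
    simp only [smul_mul_assoc, mul_smul_comm]
    match_scalars <;> field_simp

open Polynomial in
/-- The characteristic equation of the third operator. -/
theorem aeval_third_eq_zero :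
    aeval R.third (∏ k ∈ Finset.range (P.N + 1),
      (X - C (ladder (P.v ^ 2 * (P.q ^ P.N)⁻¹) (P.q ^ k)))) = 0 := by
  have hq := P.q_ne_zero
  have hroot := P.q_not_root
  have hT : P.q ^ P.N ≠ 0 := pow_ne_zero _ hq
  have hp : P.scale / 2 ≠ 0 := div_ne_zero P.scale_ne_zero two_ne_zero
  have hx : Complex.exp (-P.μ) * (P.q ^ P.N)⁻¹ ≠ 0 :=
    mul_ne_zero (Complex.exp_ne_zero _) (inv_ne_zero hT)
  have hz : P.v ^ 2 * (P.q ^ P.N)⁻¹ ≠ 0 :=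
    mul_ne_zero (pow_ne_zero _ P.v_ne_zero) (inv_ne_zero hT)
  have htr : LinearMap.trace ℂ V ((P.scale / 2)⁻¹ • R.π (genA P)) =
      ∑ i : Fin (P.N + 1), ladder (Complex.exp (-P.μ) * (P.q ^ P.N)⁻¹) (P.q ^ (i : ℕ)) := by
    rw [LinearMap.trace_eq_matrix_trace ℂ R.ket, Matrix.trace]
    refine Finset.sum_congr rfl fun i _ => ?_
    rw [Matrix.diag_apply, LinearMap.toMatrix_apply, LinearMap.smul_apply, R.A_ket, P.θ_eq,
      smul_smul, inv_mul_cancel_left₀ hp]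
    simp
  have hirr : ∀ W : Submodule ℂ V, (∀ w ∈ W, ((P.scale / 2)⁻¹ • R.π (genA P)) w ∈ W) →
      (∀ w ∈ W, ((P.scale / 2)⁻¹ • R.π (genAStar P)) w ∈ W) → W = ⊥ ∨ W = ⊤ := by
    intro W hA hB
    refine R.irreducible W (submodule_invariant_of_generators R.π ?_ ?_)
    · intro w hw
      have h := W.smul_mem (P.scale / 2) (hA w hw)
      rwa [LinearMap.smul_apply, smul_inv_smul₀ hp] at h
    · intro w hw
      have h := W.smul_mem (P.scale / 2) (hB w hw)
      rwa [LinearMap.smul_apply, smul_inv_smul₀ hp] at h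
  set y := Complex.exp P.μ' * (P.q ^ P.N)⁻¹ with hy
  have hy0 : y ≠ 0 := mul_ne_zero (Complex.exp_ne_zero _) (inv_ne_zero hT)
  have hyT : y * P.q ^ P.N = Complex.exp P.μ' := by rw [hy, inv_mul_cancel_right₀ hT]
  have hB : ∀ i, ((P.scale / 2)⁻¹ • R.π (genAStar P)) (R.ketStar i) =
      ladder y (P.q ^ (i : ℕ)) • R.ketStar i := by
    intro i
    rw [LinearMap.smul_apply, R.AStar_ketStar, P.θStar_eq, smul_smul, inv_mul_cancel_left₀ hp]
  have hinj : ∀ i ≤ P.N, ∀ j ≤ P.N, i ≠ j → ladder y (P.q ^ i) ≠ ladder y (P.q ^ j) := by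
    intro i hi j hj hij h
    have := R.θStar_injective (a₁ := ⟨i, by omega⟩) (a₂ := ⟨j, by omega⟩)
      (by simp only [P.θStar_eq, ← hy, h])
    exact hij (congrArg Fin.val this)
  have hinj_succ : ∀ {w : ℂ}, (∀ i ≤ P.N, ∀ j ≤ P.N, i ≠ j →
      ladder w (P.q ^ i) ≠ ladder w (P.q ^ j)) →
      (∀ i ≤ P.N, ladder w (P.q ^ (P.N + 1)) ≠ ladder w (P.q ^ i)) →
      ∀ i ≤ P.N + 1, ∀ j ≤ P.N + 1, i ≠ j → ladder w (P.q ^ i) ≠ ladder w (P.q ^ j) := by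
    intro w h₁ h₂ i hi j hj hij
    rcases Nat.lt_or_ge P.N i with hi' | hi' <;> rcases Nat.lt_or_ge P.N j with hj' | hj'
    · omega
    · rw [show i = P.N + 1 by omega]; exact h₂ j hj'
    · rw [show j = P.N + 1 by omega]; exact (h₂ i hi').symm
    · exact h₁ i hi' j hj' hij
  -- The argument needs `y_{N+1}` to differ from `y_0, …, y_N`. If it does not, the eigenbasis is
  -- reversed, replacing `μ'` by `-μ'`.
  by_cases hlast : ∀ i ≤ P.N, ladder y (P.q ^ (P.N + 1)) ≠ ladder y (P.q ^ i)
  · refine (R.cyclicRelations (y := y) ?_).aeval_prod_eq_zero hq hroot hx hy0 hz R.ketStar hB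
      (hinj_succ hinj hlast) htr hirr
    rw [hyT, ← Complex.exp_neg, Complex.cosh]
    ring
  · push Not at hlast
    obtain ⟨m, hm, hlast⟩ := hlast
    rw [ladder_pow_eq_iff hq hroot hy0 (by omega)] at hlast
    set y' := Complex.exp (-P.μ') * (P.q ^ P.N)⁻¹ with hy'
    have hy0' : y' ≠ 0 := mul_ne_zero (Complex.exp_ne_zero _) (inv_ne_zero hT)
    have hyT' : y' * P.q ^ P.N = Complex.exp (-P.μ') := by rw [hy', inv_mul_cancel_right₀ hT]
    have hyy : y * y' * (P.q ^ P.N) ^ 2 = 1 := by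
      rw [show y * y' * (P.q ^ P.N) ^ 2 = (y * P.q ^ P.N) * (y' * P.q ^ P.N) by ring, hyT, hyT',
        ← Complex.exp_add, add_neg_cancel, Complex.exp_zero]
    have hrev : ∀ i ≤ P.N, ladder y (P.q ^ (P.N - i)) = ladder y' (P.q ^ i) := by
      intro i hi
      have hpow : P.q ^ P.N = P.q ^ (P.N - i) * P.q ^ i := by rw [← pow_add, Nat.sub_add_cancel hi]
      have hinv : y * (P.q ^ (P.N - i)) ^ 2 = (y' * (P.q ^ i) ^ 2)⁻¹ := by
        apply eq_inv_of_mul_eq_one_left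
        rw [hpow] at hyy
        linear_combination hyy
      rw [ladder, ladder, hinv, inv_inv, add_comm]
    have hinj' : ∀ i ≤ P.N, ∀ j ≤ P.N, i ≠ j → ladder y' (P.q ^ i) ≠ ladder y' (P.q ^ j) := by
      intro i hi j hj hij
      rw [← hrev i hi, ← hrev j hj]
      exact hinj _ (by omega) _ (by omega) (by omega)
    refine (R.cyclicRelations (y := y') ?_).aeval_prod_eq_zero hq hroot hx hy0' hz
      (R.ketStar.reindex Fin.revPerm) ?_ (hinj_succ hinj' ?_) htr hirr
    · rw [hyT', ← Complex.exp_neg, Complex.cosh, neg_neg]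
      ring
    · intro i
      rw [Module.Basis.reindex_apply, hB, ← hrev i (by omega)]
      simp [Fin.val_rev]
    -- Both orderings cannot fail: multiplying the two coincidences and using `y y' q^{2N} = 1`
    -- makes a positive power of `q` equal to `1`.
    · intro i hi h
      rw [ladder_pow_eq_iff hq hroot hy0' (by omega)] at h
      refine hroot ((m + 1 + (i + 1)) * 2) (by omega) ?_
      have e : y ^ 2 * (P.q ^ (P.N + 1)) ^ 2 * (P.q ^ m) ^ 2 *
          (y' ^ 2 * (P.q ^ (P.N + 1)) ^ 2 * (P.q ^ i) ^ 2) = 1 := by rw [hlast, h, one_mul]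
      calc P.q ^ ((m + 1 + (i + 1)) * 2)
          = (y * y' * (P.q ^ P.N) ^ 2) ^ 2 * P.q ^ ((m + 1 + (i + 1)) * 2) := by
            rw [hyy, one_pow, one_mul]
        _ = 1 := by rw [← e]; ring

end Rep

/-! ### Bethe vectors as polynomials in the third operator -/

open Polynomial

/-- The scalar prefactor of `ℬ^ε(u, m)` in the gauge `β = 0`, without its dependence on `u`. -/
def gaugeFactor (P : Params) (α : ℂ) (ε : ℤˣ) (m : ℤ) : ℂ :=
  -((ε : ℤ) : ℂ) * (P.q ^ (-(ε : ℤ)) / γ P α 0 ε 1 (m + 1)) *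
    (P.χ / (P.q ^ 2 - (P.q ^ 2)⁻¹))

/-- The gauge condition expresses `χ / (q² - q⁻²)` as a multiple of `α`, which cancels the `α` in
`γ`. The sign `(-1)^N` will cancel the one from interpolation. -/
theorem gaugeFactor_eq {P : Params} {α : ℂ} {ε : ℤˣ} {m₀ : ℤ} (hα : RefGauge P α ε m₀) :
    gaugeFactor P α ε (m₀ + 2 * P.N) = (-1) ^ P.N * δd P ε := by
  have hq := P.q_ne_zero
  have hκ := P.q_sq_sub_inv_ne_zero
  have hχ := P.χ_ne_zero
  have hm : P.q ^ m₀ ≠ 0 := zpow_ne_zero _ hq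
  have hsign : ((-1 : ℂ) ^ P.N) * (-1) ^ (P.N + 1) = -1 := by
    rw [← pow_add]; exact Odd.neg_one_pow ⟨P.N, by ring⟩
  rcases Int.units_eq_one_or ε with rfl | rfl
  · rw [RefGauge, if_pos rfl] at hα
    have hα0 : α ≠ 0 := by rintro rfl; simp at hα
    have hδ : (-1) ^ P.N * δd P 1 =
        1 / 2 * Complex.exp (-P.μ') * P.scale * (P.q ^ (P.N + 2))⁻¹ := by
      have e₁ : P.q ^ ((P.ν + P.ν') / 2 - (((1 : ℤˣ) : ℤ) : ℂ) * (2 * P.s + 2)) =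
          P.scale * (P.q ^ (P.N + 2))⁻¹ := by
        rw [Complex.cpow_sub _ _ hq, Params.scale, div_eq_mul_inv, ← Complex.cpow_natCast]
        congr 3
        unfold Params.s
        push_cast
        ring
      rw [δd, e₁]
      have e₂ : -P.μ * (1 - (((1 : ℤˣ) : ℤ) : ℂ)) / 2 - P.μ' * (1 + (((1 : ℤˣ) : ℤ) : ℂ)) / 2 =
          -P.μ' := by push_cast; ring
      rw [e₂]
      push_cast
      linear_combination (-(1 / 2) * Complex.exp (-P.μ') * P.scale * (P.q ^ (P.N + 2))⁻¹) * hsign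
    have hγ : γ P α 0 1 1 (m₀ + 2 * P.N + 1) = -(α * (P.q ^ m₀ * (P.q ^ P.N) ^ 2 * P.q)) := by
      rw [γ, zpow_add₀ hq, zpow_add₀ hq, zpow_one, mul_comm 2 (P.N : ℤ), zpow_mul, zpow_natCast]
      simp
    rw [hδ, gaugeFactor, hγ]
    rw [Params.cStar, ← Params.scale, zpow_natCast] at hα
    have hs : P.χ / (P.q ^ 2 - (P.q ^ 2)⁻¹) =
        α * (1 / 2 * P.scale * Complex.exp (-P.μ') * P.q ^ P.N) * P.q ^ m₀ := by
      generalize P.q ^ 2 - (P.q ^ 2)⁻¹ = κ at *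
      field_simp at hα ⊢
      linear_combination -hα
    rw [hs, pow_add]
    simp only [Units.val_one, Int.cast_one, zpow_neg, zpow_one]
    field_simp
  · rw [RefGauge, if_neg (by decide)] at hα
    have hα0 : α ≠ 0 := by rintro rfl; simp at hα
    have hδ : (-1) ^ P.N * δd P (-1) =
        -(1 / 2) * Complex.exp (-P.μ) * P.scale * P.q ^ (P.N + 2) := by
      have e₁ : P.q ^ ((P.ν + P.ν') / 2 - (((-1 : ℤˣ) : ℤ) : ℂ) * (2 * P.s + 2)) =
          P.scale * P.q ^ (P.N + 2) := by
        rw [Params.scale, ← Complex.cpow_natCast, ← Complex.cpow_add _ _ hq]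
        congr 1
        unfold Params.s
        push_cast
        ring
      rw [δd, e₁]
      have e₂ : -P.μ * (1 - (((-1 : ℤˣ) : ℤ) : ℂ)) / 2
          - P.μ' * (1 + (((-1 : ℤˣ) : ℤ) : ℂ)) / 2 = -P.μ := by push_cast; ring
      rw [e₂]
      push_cast
      linear_combination (1 / 2 * Complex.exp (-P.μ) * P.scale * P.q ^ (P.N + 2)) * hsign
    have hγ : γ P α 0 (-1) 1 (m₀ + 2 * P.N + 1) = α * (P.q ^ m₀ * (P.q ^ P.N) ^ 2 * P.q)⁻¹ := by
      rw [γ, zpow_neg, zpow_add₀ hq, zpow_add₀ hq, zpow_one, mul_comm 2 (P.N : ℤ), zpow_mul,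
        zpow_natCast]
      simp
    rw [hδ, gaugeFactor, hγ]
    rw [Params.b, ← Params.scale, zpow_neg, zpow_neg, zpow_natCast] at hα
    have hs : P.χ / (P.q ^ 2 - (P.q ^ 2)⁻¹) =
        -(α * (1 / 2 * P.scale * Complex.exp (-P.μ) * (P.q ^ P.N)⁻¹) * (P.q ^ m₀)⁻¹) := by
      generalize P.q ^ 2 - (P.q ^ 2)⁻¹ = κ at *
      field_simp at hα ⊢
      linear_combination hα
    rw [hs, pow_add]
    simp only [Units.val_neg, Units.val_one, Int.cast_neg, Int.cast_one, neg_neg, zpow_one]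
    field_simp

variable {P : Params} {V : Type*} [AddCommGroup V] [Module ℂ V] (R : Rep P V)

/-- At `β = 0` the covariant vector is `(0, 1)` and the contravariant one is proportional to `(1,
0)`, which selects `K₁₂`. -/
theorem Rep.map_dynB (α : ℂ) (ε : ℤˣ) (u : ℂ) (m : ℤ) :
    R.π (dynB P α 0 ε u m) = aeval R.third
      (C (gaugeFactor P α ε m * (u ^ (-(ε : ℤ)) * bfun (u ^ 2))) *
        (C (spectralVar P.q u) - X)) := by
  have hκ := P.q_sq_sub_inv_ne_zero
  have hdyn : dynB P α 0 ε u m =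
      (-((ε : ℤ) : ℂ) * (P.q ^ (-(ε : ℤ)) * u ^ (-(ε : ℤ)) / γ P α 0 ε 1 (m + 1))) •
        K P u 0 1 := by
    simp [dynB, contraY, covY, Fin.sum_univ_two]
  rw [hdyn, ← smul_eq_C_mul, map_smul, map_smul, map_sub, aeval_C, aeval_X,
    Algebra.algebraMap_eq_smul_one]
  simp only [K, Matrix.of_apply, Matrix.cons_val', Matrix.cons_val_zero, Matrix.cons_val_one,
    Matrix.cons_val_fin_one, map_smul, map_add, map_sub, map_mul, map_one, qComm, Rep.third,
    gaugeFactor, spectralVar, bfun]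
  generalize P.q ^ 2 - (P.q ^ 2)⁻¹ = κ at *
  generalize P.q * u ^ 2 + P.q⁻¹ * (u ^ 2)⁻¹ = x
  generalize u ^ 2 - (u ^ 2)⁻¹ = w
  generalize P.ω / (P.q - P.q⁻¹) = ω
  match_scalars <;> field_simp <;> ring

/-- The vector `∏_j (x_j - C) |Ω^ε⟩`, where `C` is the third operator. -/
def nodeVec (ε : ℤˣ) (x : Fin P.N → ℂ) : V :=
  aeval R.third (∏ j, (C (x j) - X)) (refState R ε)

theorem betheVec_eq (α : ℂ) (ε : ℤˣ) (ubar : Fin P.N → ℂ) (m₀ : ℤ) :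
    betheVec R α ε ubar m₀ =
      ((∏ i : Fin P.N, gaugeFactor P α ε (m₀ + 2 * ((P.N : ℤ) - 1 - ((i : ℕ) : ℤ)))) *
        ∏ i, (ubar i ^ (-(ε : ℤ)) * bfun (ubar i ^ 2))) •
      nodeVec R ε fun i => spectralVar P.q (ubar i) := by
  rw [betheVec, stringB, map_list_prod, List.map_ofFn]
  have : (R.π ∘ fun i : Fin P.N =>
      dynB P α 0 ε (ubar i) (m₀ + 2 * ((P.N : ℤ) - 1 - ((i : ℕ) : ℤ)))) =
      aeval R.third ∘ fun i : Fin P.N =>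
        (C (gaugeFactor P α ε (m₀ + 2 * ((P.N : ℤ) - 1 - ((i : ℕ) : ℤ))) *
          (ubar i ^ (-(ε : ℤ)) * bfun (ubar i ^ 2))) * (C (spectralVar P.q (ubar i)) - X)) := by
    funext i
    exact R.map_dynB _ _ _ _
  rw [this, ← List.map_ofFn, ← map_list_prod, List.prod_ofFn, Finset.prod_mul_distrib,
    ← map_prod, Finset.prod_mul_distrib, ← smul_eq_C_mul, map_smul, LinearMap.smul_apply, nodeVec]

theorem nodeVec_interpolation (ε : ℤˣ) (x₀ : ℂ) (x : Fin P.N → ℂ)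
    (h₀ : ∀ i, x i - x₀ ≠ 0) (h : ∀ i j, i ≠ j → x j - x i ≠ 0) :
    aeval R.third (C x₀ - X) (nodeVec R ε x) =
      ((-1) ^ P.N * (∏ k ∈ Finset.range (P.N + 1),
          (x₀ - ladder (P.v ^ 2 * (P.q ^ P.N)⁻¹) (P.q ^ k))) / ∏ i, (x i - x₀)) • nodeVec R ε x
      - ∑ i, ((-1) ^ P.N * (∏ k ∈ Finset.range (P.N + 1),
            (x i - ladder (P.v ^ 2 * (P.q ^ P.N)⁻¹) (P.q ^ k))) /
            ((x i - x₀) * ∏ j ∈ Finset.univ.erase i, (x j - x i))) •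
          nodeVec R ε (Function.update x i x₀) := by
  rw [nodeVec, ← Module.End.mul_apply, ← map_mul, prod_sub_X_eq_interpolation
    (fun k => ladder (P.v ^ 2 * (P.q ^ P.N)⁻¹) (P.q ^ k)) x₀ x h₀ h]
  simp only [← smul_eq_C_mul, map_sub, map_add, map_smul, map_sum, R.aeval_third_eq_zero, smul_zero,
    zero_add, LinearMap.sub_apply, LinearMap.smul_apply, LinearMap.sum_apply, nodeVec]

end

end AskeyWilson

open AskeyWilson in
theorem lemma3p5 (P : Params) {V : Type*} [AddCommGroup V] [Module ℂ V] (R : Rep P V)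
    (ε : ℤˣ) (m₀ : ℤ) (α : ℂ) (hα : RefGauge P α ε m₀)
    (u : ℂ) (ubar : Fin P.N → ℂ) (hu : u ≠ 0) (hubar : ∀ i, ubar i ≠ 0)
    (hgen : ∀ i, bfun (u * (ubar i)⁻¹) ≠ 0 ∧ bfun (P.q⁻¹ * u⁻¹ * (ubar i)⁻¹) ≠ 0)
    (hgen' : ∀ i j, i ≠ j →
      bfun (ubar i * (ubar j)⁻¹) ≠ 0 ∧ bfun (P.q⁻¹ * (ubar i)⁻¹ * (ubar j)⁻¹) ≠ 0) :
    R.π (dynB P α 0 ε u (m₀ + 2 * P.N)) (betheVec R α ε ubar m₀) =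
      (δd P ε *
          (u ^ (-(ε : ℤ)) * bfun (u ^ 2) *
            ∏ k ∈ Finset.range (P.N + 1),
              (bfun (P.q ^ (1 / 2 + (k : ℂ) - P.s) * P.v * u) *
                bfun (P.q ^ (1 / 2 + (k : ℂ) - P.s) * P.v⁻¹ * u))) /
          ∏ i, (bfun (u * (ubar i)⁻¹) * bfun (P.q⁻¹ * u⁻¹ * (ubar i)⁻¹))) •
        betheVec R α ε ubar m₀
      - δd P ε • ∑ i,
          ((ubar i ^ (-(ε : ℤ)) * bfun (ubar i ^ 2) *
            ∏ k ∈ Finset.range (P.N + 1),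
              (bfun (P.q ^ (1 / 2 + (k : ℂ) - P.s) * P.v * ubar i) *
                bfun (P.q ^ (1 / 2 + (k : ℂ) - P.s) * P.v⁻¹ * ubar i))) /
            (bfun (u * (ubar i)⁻¹) * bfun (P.q⁻¹ * u⁻¹ * (ubar i)⁻¹) *
              ∏ j ∈ Finset.univ.erase i,
                (bfun (ubar i * (ubar j)⁻¹) * bfun (P.q⁻¹ * (ubar i)⁻¹ * (ubar j)⁻¹)))) •
          betheVec R α ε (Function.update ubar i u) m₀ := by
  have hq := P.q_ne_zero
  have hb₀ : ∀ i, bfun (u * (ubar i)⁻¹) * bfun (P.q⁻¹ * u⁻¹ * (ubar i)⁻¹) =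
      spectralVar P.q (ubar i) - spectralVar P.q u := fun i => bfun_mul_bfun hq hu (hubar i)
  have hb : ∀ i j, bfun (ubar i * (ubar j)⁻¹) * bfun (P.q⁻¹ * (ubar i)⁻¹ * (ubar j)⁻¹) =
      spectralVar P.q (ubar j) - spectralVar P.q (ubar i) :=
    fun i j => bfun_mul_bfun hq (hubar i) (hubar j)
  have hn₀ : ∀ i, spectralVar P.q (ubar i) - spectralVar P.q u ≠ 0 := fun i => by
    rw [← hb₀]; exact mul_ne_zero (hgen i).1 (hgen i).2
  have hn : ∀ i j, i ≠ j → spectralVar P.q (ubar j) - spectralVar P.q (ubar i) ≠ 0 :=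
    fun i j hij => by rw [← hb]; exact mul_ne_zero (hgen' i j hij).1 (hgen' i j hij).2
  have hupdate : ∀ i, (fun j => spectralVar P.q (Function.update ubar i u j)) =
      Function.update (fun j => spectralVar P.q (ubar j)) i (spectralVar P.q u) :=
    fun i => Function.comp_update (spectralVar P.q) ubar i u
  -- Replacing `u_i` by `u` trades one factor of the Bethe normalisation for another. The identity
  -- is cross-multiplied because `b(u_i²)` may vanish.
  have hprod : ∀ i, (ubar i ^ (-(ε : ℤ)) * bfun (ubar i ^ 2)) *
      ∏ j, (Function.update ubar i u j ^ (-(ε : ℤ)) * bfun (Function.update ubar i u j ^ 2)) =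
      (u ^ (-(ε : ℤ)) * bfun (u ^ 2)) * ∏ j, (ubar j ^ (-(ε : ℤ)) * bfun (ubar j ^ 2)) := by
    intro i
    rw [← Finset.mul_prod_erase _ _ (Finset.mem_univ i), Function.update_self,
      ← Finset.mul_prod_erase _ (fun j => ubar j ^ (-(ε : ℤ)) * bfun (ubar j ^ 2))
        (Finset.mem_univ i), Finset.prod_congr rfl (g := fun j =>
        ubar j ^ (-(ε : ℤ)) * bfun (ubar j ^ 2)) fun j hj => by
          rw [Function.update_of_ne (Finset.ne_of_mem_erase hj)]]
    ring
  have hsign : ((-1 : ℂ) ^ P.N) * (-1) ^ P.N = 1 := by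
    rw [← mul_pow, neg_one_mul, neg_neg, one_pow]
  simp only [hb₀, hb, prod_bfun_eq P hu, prod_bfun_eq P (hubar _), betheVec_eq, hupdate, map_smul]
  rw [R.map_dynB, gaugeFactor_eq hα, map_mul, Module.End.mul_apply,
    nodeVec_interpolation R ε _ _ hn₀ hn, Polynomial.aeval_C, Module.algebraMap_end_apply]
  simp only [smul_sub, Finset.smul_sum, smul_smul]
  congr 1
  · congr 1
    linear_combination
      (δd P ε * (u ^ (-(ε : ℤ)) * bfun (u ^ 2) * ∏ k ∈ Finset.range (P.N + 1),
        (spectralVar P.q u - ladder (P.v ^ 2 * (P.q ^ P.N)⁻¹) (P.q ^ k))) /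
        (∏ i, (spectralVar P.q (ubar i) - spectralVar P.q u)) *
        ((∏ i : Fin P.N, gaugeFactor P α ε (m₀ + 2 * ((P.N : ℤ) - 1 - ((i : ℕ) : ℤ)))) *
          ∏ i, (ubar i ^ (-(ε : ℤ)) * bfun (ubar i ^ 2)))) * hsign
  · refine Finset.sum_congr rfl fun i _ => ?_
    congr 1
    set D := (spectralVar P.q (ubar i) - spectralVar P.q u) *
      ∏ j ∈ Finset.univ.erase i, (spectralVar P.q (ubar j) - spectralVar P.q (ubar i))
    set F := ∏ k ∈ Finset.range (P.N + 1),
      (spectralVar P.q (ubar i) - ladder (P.v ^ 2 * (P.q ^ P.N)⁻¹) (P.q ^ k))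
    set G := ∏ i : Fin P.N, gaugeFactor P α ε (m₀ + 2 * ((P.N : ℤ) - 1 - ((i : ℕ) : ℤ)))
    linear_combination
      (δd P ε * (u ^ (-(ε : ℤ)) * bfun (u ^ 2)) * F / D * G *
        ∏ i, (ubar i ^ (-(ε : ℤ)) * bfun (ubar i ^ 2))) * hsign
      - δd P ε * F / D * G * hprod i
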